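/- **Setting.** Let $K\ge 1$ and let $F=f_K\circ\cdots\circ f_1:\mathbb R^d\to\mathbb R$ with layers $f_i:\mathbb R^{d_{i-1}}\to\mathbb R^{d_i}$, $d_0=d$, $d_K=1$. Every $f_i$ is $L_f$-Lipschitz and differentiable with $L_J$-Lipschitz Jacobian. A sample $\xi$ of level $i$ gives $f_i(x;\xi)$ and $\nabla f_i(x;\xi)$ at any queried points $x$, with means $f_i(x)$ and $\nabla f_i(x)$, variances $\mathbb E\|f_i(x;\xi)-f_i(x)\|^2\le\sigma_f^2$ and $\mathbb E\|\nabla f_i(x;\xi)-\nabla f_i(x)\|_F^2\le\sigma_J^2$, and $\mathbb E\|f_i(x;\xi)-f_i(y;\xi)\|^2\le\mathcal L_f^2\|x-y\|^2$, $\mathbb E\|\nabla f_i(x;\xi)-\nabla f_i(y;\xi)\|_F^2\le\mathcal L_J^2\|x-y\|^2$. Let $F_*=\inf F$, and let the initial point $w_0$ satisfy $F(w_0)-F_*\le\Delta$ and $\|w_0\|\le R$. **Algorithm.** Let $\mu>0$. A state consists of $w=u^0$, function value estimates $u^1,\dots,u^K$ and Jacobian estimates $v^1,\dots,v^K$. The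 initial state has $u^0=w_0$, $u^i=f_i(u^{i-1};\xi^i)$, $v^i=\nabla f_i(u^{i-1};\xi^i)$. SMVR with learning rate $\eta$, parameter $a$ and $T$ time steps, applied to $F+\frac\mu2\|\cdot\|^2$, starts at time $1$ from a given state; with $\beta=a\eta^2$, with $v_t\in\mathbb R^d$ the gradient estimate obtained from $v_t^1,\dots,v_t^K$ by the chain rule, and with fresh independent samples $\xi^1,\dots,\xi^K$ at every time step, it sets $$w_{t+1}=u_{t+1}^0=w_t-\eta(v_t+\mu w_t),$$ $$u_{t+1}^i=(1-\beta)u_t^i+\beta f_i(u_{t+1}^{i-1};\xi^i)+(1-\beta)\bigl(f_i(u_{t+1}^{i-1};\xi^i)-f_i(u_t^{i-1};\xi^i)\bigr),$$ $$v_{t+1}^i=\Pi\bigl[(1-\beta)v_t^i+\beta\nabla f_i(u_{t+1}^{i-1};\xi^i)+(1-\beta)\bigl(\nabla f_i(u_{t+1}^{i-1};\xi^i)-\nabla f_i(u_t^{i-1};\xi^i)\bigr)\bigr],$$ where $\Pi$ is the Frobenius projection onto the matrices of operator norm at most $L_f$, and it returns the state of a time step chosen uniformly from $\{1,\dots,T\}$.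 Stage-wise SMVR runs SMVR in stages $s=1,\dots,S$, stage $s$ with $\eta_s$ and $T_s$ and starting from the state returned by the previous stage, and returns the last $w$. For an accuracy $\epsilon$ and a constant $L$ its parameters are $\mu=\epsilon/D^2$, $a=16L^2$, $L_2=64L^2$, $\epsilon_s=\frac{8L}{\mu}2^{-(s-1)}$, $\eta_s=\sqrt{\beta_s/a}$, $S=\lceil\log_2\frac{2\epsilon_1}{\epsilon/2}\rceil$, $\beta_1=\frac1{2L}$, $T_1=\max\{1,\lceil4LK(\sigma_f^2+\sigma_J^2)\rceil,\lceil2\sqrt{2L}\,(\Delta+\frac\mu2R^2)\rceil\}$ and, for $s\ge2$, $\beta_s=\frac{\mu\epsilon_{s-1}}{L_2}$, $T_s=\bigl\lceil\max\{\frac{4L_2^{3/2}}{\mu\epsilon_{s-1}},\frac{4L_2}{\mu^{3/2}\sqrt{\epsilon_{s-1}}}\}\bigr\rceil$. **Theorem.** Let $D>0$. There is an $L_0$, depending only on $K,L_f,L_J,\sigma_f,\sigma_J,\mathcal L_f,\mathcal L_J,\Delta,R,D$, such that for every $L\ge L_0$ there is a $C$, depending only on $L$ and these constants, with the following property. If $F$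 is convex and has a minimizer of norm at most $D$, then for every $\epsilon\in(0,1]$ Stage-wise SMVR with these parameters, applied to $F+\frac\mu2\|\cdot\|^2$ with $\mu=\epsilon/D^2$, returns a point $w_S$ with $\mathbb E[F(w_S)-F_*]\le\epsilon$ and uses at most $K\sum_{s=1}^ST_s\le C/\epsilon^2$ samples. -/

import Mathlib

open MeasureTheory ProbabilityTheory
open scoped NNReal ENNReal

namespace SMVR

/-- `ℝⁿ` with the Euclidean norm. -/
abbrev Vec (n : ℕ) : Type := EuclideanSpace ℝ (Fin n)

/-- Jacobians of maps `ℝᵐ → ℝⁿ`; the norm of this type is the operator norm. -/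
abbrev Jac (m n : ℕ) : Type := Vec m →L[ℝ] Vec n

/-- The squared Euclidean (Frobenius) norm of a Jacobian: the sum of its squared entries. -/
noncomputable def frobSq {m n : ℕ} (A : Jac m n) : ℝ :=
  ∑ j : Fin m, ∑ k : Fin n, (A (EuclideanSpace.single j 1) k) ^ 2

/-- A point of the ball of radius `r` that is closest to `A` exists. -/
theorem exists_proj {m n : ℕ} (r : ℝ≥0) (A : Jac m n) :
    ∃ B : Jac m n, ‖B‖ ≤ r ∧ ∀ B' : Jac m n, ‖B'‖ ≤ r → frobSq (B - A) ≤ frobSq (B' - A) := by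
  have : ProperSpace (Jac m n) := FiniteDimensional.proper ℝ _
  have hc : Continuous fun B : Jac m n => frobSq (B - A) := by
    unfold frobSq
    fun_prop
  obtain ⟨B, hB, h⟩ := (isCompact_closedBall (0 : Jac m n) (r : ℝ)).exists_isMinOn
    ⟨0, by simp⟩ hc.continuousOn
  exact ⟨B, by simpa using hB, fun B' hB' => h (by simpa using hB')⟩

/-- The projection onto the ball of radius `r`: the point of the ball that is closest in the
Euclidean norm. The ball is that of the operator norm, so that it contains every Jacobian
of an `r`-Lipschitz map. -/
noncomputable def proj {m n : ℕ} (r : ℝ≥0) (A : Jac m n) : Jac m n :=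
  (exists_proj r A).choose

/-- The constants of a problem class. -/
structure Constants where
  /-- number of levels -/
  K : ℕ
  K_pos : 0 < K
  /-- Lipschitz constant of the layers -/
  Lf : ℝ≥0
  /-- Lipschitz constant of the Jacobians of the layers -/
  LJ : ℝ≥0
  /-- standard deviation of the function value oracle -/
  σf : ℝ≥0
  /-- standard deviation of the Jacobian oracle -/
  σJ : ℝ≥0
  /-- mean-squared Lipschitz constant of the function value oracle -/
  msLf : ℝ≥0
  /-- mean-squared Lipschitz constant of the Jacobian oracle -/
  msLJ : ℝ≥0
  /-- bound on the initial optimality gap -/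
  Δ : ℝ≥0
  /-- bound on the norm of the initial point -/
  R : ℝ≥0
  /-- bound on the norm of a minimizer -/
  D : ℝ≥0
  D_pos : 0 < D

/-- A stochastic `K`-level compositional problem. Layers are numbered from `0`: the layer `f i`,
for `i < K`, maps `ℝ^(d i)` to `ℝ^(d (i + 1))`; nothing is used or assumed of the layers `i ≥ K`.
`g i x z` is the noisy value of the layer `f i` at `x` for the sample `z`, and `law i` is the
distribution of the samples of this layer. -/
structure Problem (K : ℕ) (Ξ : Type*) [MeasurableSpace Ξ] where
  d : ℕ → ℕ
  d_last : d K = 1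
  f : (i : ℕ) → Vec (d i) → Vec (d (i + 1))
  g : (i : ℕ) → Vec (d i) → Ξ → Vec (d (i + 1))
  law : ℕ → Measure Ξ

namespace Problem

variable {K : ℕ} {Ξ : Type*} [MeasurableSpace Ξ] (P : Problem K Ξ)

/-- The Jacobian `∇f_i(x)`. -/
noncomputable def df (i : ℕ) (x : Vec (P.d i)) : Jac (P.d i) (P.d (i + 1)) :=
  fderiv ℝ (P.f i) x

/-- The noisy Jacobian `∇f_i(x; z)`. -/
noncomputable def dg (i : ℕ) (x : Vec (P.d i)) (z : Ξ) : Jac (P.d i) (P.d (i + 1)) :=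
  fderiv ℝ (fun y => P.g i y z) x

/-- The composition of the first `k` layers. -/
def comp : (k : ℕ) → Vec (P.d 0) → Vec (P.d k)
  | 0, w => w
  | k + 1, w => P.f k (comp k w)

/-- The only index of the one-dimensional last space. -/
def last : Fin (P.d K) := ⟨0, by rw [P.d_last]; exact Nat.one_pos⟩

/-- The objective, the composition of all `K` layers. -/
def F (w : Vec (P.d 0)) : ℝ := P.comp K w P.last

/-- The product of the Jacobian estimates of the first `k` layers. -/
noncomputable def chain (v : (i : ℕ) → Jac (P.d i) (P.d (i + 1))) :
    (k : ℕ) → Jac (P.d 0) (P.d k)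
  | 0 => ContinuousLinearMap.id ℝ _
  | k + 1 => (v k).comp (chain v k)

/-- The gradient vector in `ℝ^(d 0)` given by the chain rule from Jacobian estimates. -/
noncomputable def grad (v : (i : ℕ) → Jac (P.d i) (P.d (i + 1))) : Vec (P.d 0) :=
  ContinuousLinearMap.adjoint (P.chain v K) (EuclideanSpace.single P.last 1)

/-- The standing assumptions: smoothness and Lipschitz continuity of the layers, an unbiased oracle
with bounded variance, and mean-squared smoothness of the oracle. -/
structure Assumptions (c : Constants) (P : Problem c.K Ξ) : Prop where
  prob : ∀ i < c.K, IsProbabilityMeasure (P.law i)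
  f_lip : ∀ i < c.K, LipschitzWith c.Lf (P.f i)
  f_diff : ∀ i < c.K, Differentiable ℝ (P.f i)
  df_lip : ∀ i < c.K, LipschitzWith c.LJ (P.df i)
  g_diff : ∀ i < c.K, ∀ z, Differentiable ℝ (fun x => P.g i x z)
  g_meas : ∀ i < c.K, Measurable (fun p : Vec (P.d i) × Ξ => P.g i p.1 p.2)
  dg_meas : ∀ i < c.K, Measurable (fun p : Vec (P.d i) × Ξ => P.dg i p.1 p.2)
  g_mean : ∀ i < c.K, ∀ x, Integrable (P.g i x) (P.law i) ∧ ∫ z, P.g i x z ∂P.law i = P.f i x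
  dg_mean : ∀ i < c.K, ∀ x,
    Integrable (P.dg i x) (P.law i) ∧ ∫ z, P.dg i x z ∂P.law i = P.df i x
  g_var : ∀ i < c.K, ∀ x, Integrable (fun z => ‖P.g i x z - P.f i x‖ ^ 2) (P.law i) ∧
    ∫ z, ‖P.g i x z - P.f i x‖ ^ 2 ∂P.law i ≤ (c.σf : ℝ) ^ 2
  dg_var : ∀ i < c.K, ∀ x, Integrable (fun z => frobSq (P.dg i x z - P.df i x)) (P.law i) ∧
    ∫ z, frobSq (P.dg i x z - P.df i x) ∂P.law i ≤ (c.σJ : ℝ) ^ 2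
  g_ms : ∀ i < c.K, ∀ x y, Integrable (fun z => ‖P.g i x z - P.g i y z‖ ^ 2) (P.law i) ∧
    ∫ z, ‖P.g i x z - P.g i y z‖ ^ 2 ∂P.law i ≤ (c.msLf : ℝ) ^ 2 * ‖x - y‖ ^ 2
  dg_ms : ∀ i < c.K, ∀ x y, Integrable (fun z => frobSq (P.dg i x z - P.dg i y z)) (P.law i) ∧
    ∫ z, frobSq (P.dg i x z - P.dg i y z) ∂P.law i ≤ (c.msLJ : ℝ) ^ 2 * ‖x - y‖ ^ 2

/-- The state of the algorithm at one time step. `u 0` is the iterate `w`, `u (i + 1)` is the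
estimate of `f i (u i)`, and `v i` is the estimate of `∇f_i (u i)`. -/
structure State where
  u : (i : ℕ) → Vec (P.d i)
  v : (i : ℕ) → Jac (P.d i) (P.d (i + 1))

variable {P}

/-- The iterate `w`. -/
def State.w (x : P.State) : Vec (P.d 0) := x.u 0

variable (P)

/-- Function value estimates of the very first time step, from one sample `z i` per level. -/
def initU (w : Vec (P.d 0)) (z : ℕ → Ξ) : (i : ℕ) → Vec (P.d i)
  | 0 => w
  | i + 1 => P.g i (initU w z i) (z i)

/-- The state of the very first time step, from one sample `z i` per level. -/
noncomputable def initState (w : Vec (P.d 0)) (z : ℕ → Ξ) : P.State where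
  u := P.initU w z
  v := fun i => P.dg i (P.initU w z i) (z i)

/-- The weight update for the objective `F + (μ/2)‖·‖²`; the gradient `μ w` of the regularizer is
known and is added to the estimate of `∇F(w)`. -/
noncomputable def nextW (μ η : ℝ) (x : P.State) : Vec (P.d 0) :=
  x.w - η • (P.grad x.v + μ • x.w)

/-- Function value estimates of the next time step, from one new sample `z i` per level. -/
noncomputable def nextU (μ η β : ℝ) (x : P.State) (z : ℕ → Ξ) : (i : ℕ) → Vec (P.d i)
  | 0 => P.nextW μ η x
  | i + 1 => (1 - β) • x.u (i + 1) + β • P.g i (nextU μ η β x z i) (z i)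
      + (1 - β) • (P.g i (nextU μ η β x z i) (z i) - P.g i (x.u i) (z i))

/-- Jacobian estimates of the next time step, from the same samples. -/
noncomputable def nextV (Lf : ℝ≥0) (μ η β : ℝ) (x : P.State) (z : ℕ → Ξ) (i : ℕ) :
    Jac (P.d i) (P.d (i + 1)) :=
  proj Lf ((1 - β) • x.v i + β • P.dg i (P.nextU μ η β x z i) (z i)
      + (1 - β) • (P.dg i (P.nextU μ η β x z i) (z i) - P.dg i (x.u i) (z i)))

/-- From one time step to the next. -/
noncomputable def step (Lf : ℝ≥0) (μ η β : ℝ) (x : P.State) (z : ℕ → Ξ) : P.State where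
  u := P.nextU μ η β x z
  v := P.nextV Lf μ η β x z

/-- SMVR with parameter `a`, constant learning rate `η` and momentum `β = a η²`, applied to
`F + (μ/2)‖·‖²`, from the state `x` at time `1`: the state at time `n + 1`. -/
noncomputable def smvr (Lf : ℝ≥0) (μ a η : ℝ) (x : P.State) (z : ℕ → ℕ → Ξ) : ℕ → P.State
  | 0 => x
  | n + 1 => P.step Lf μ η (a * η ^ 2) (smvr Lf μ a η x z n) (z n)

/-- Stage-wise SMVR with learning rate `η s` in stage `s`, applied to `F + (μ/2)‖·‖²`: the state
that stage `s = 1, 2, …` returns, for the samples `ξ` and the random choices `τ s` of the returned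
time step (`τ s = n` means time `n + 1`). Stage `s + 1` starts from the whole state returned by stage
`s`; the value at `0` is the initial state. -/
noncomputable def stagewise (Lf : ℝ≥0) (μ a : ℝ) (η : ℕ → ℝ) (w₀ : Vec (P.d 0))
    (ξ : ℕ → ℕ → ℕ → Ξ) (τ : ℕ → ℕ) : ℕ → P.State
  | 0 => P.initState w₀ (ξ 0 0)
  | s + 1 => P.smvr Lf μ a (η (s + 1)) (stagewise Lf μ a η w₀ ξ τ s) (ξ (s + 1)) (τ (s + 1))

/-- The randomness of the algorithm on a probability space: `ξ s n i` is the sample of level `i` for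
the `n`-th update in stage `s`, drawn from `law i`; `τ s` is uniform on the `T s` time steps of
stage `s`; all of them are independent. -/
structure Sampling {Ω : Type*} [MeasurableSpace Ω] (Pr : Measure Ω) (T : ℕ → ℕ)
    (ξ : ℕ → ℕ → ℕ → Ω → Ξ) (τ : ℕ → Ω → ℕ) : Prop where
  ξ_meas : ∀ s n i, Measurable (ξ s n i)
  ξ_law : ∀ s n, ∀ i < K, Pr.map (ξ s n i) = P.law i
  τ_meas : ∀ s, Measurable (τ s)
  τ_law : ∀ s, 1 ≤ s → ∀ n < T s, Pr (τ s ⁻¹' {n}) = (T s : ℝ≥0∞)⁻¹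
  ξ_indep : iIndepFun (fun (p : ℕ × ℕ × ℕ) ω => ξ p.1 p.2.1 p.2.2 ω) Pr
  τ_indep : iIndepFun τ Pr
  ξ_τ_indep : IndepFun (fun ω (p : ℕ × ℕ × ℕ) => ξ p.1 p.2.1 p.2.2 ω) (fun ω s => τ s ω) Pr

end Problem

namespace Constants

variable (c : Constants)

/-- The weight `μ` of the regularizer for the accuracy `ε`. -/
noncomputable def mu (ε : ℝ) : ℝ := ε / (c.D : ℝ) ^ 2

/-- Bound on the initial optimality gap of the regularized objective. -/
noncomputable def gap (ε : ℝ) : ℝ := c.Δ + c.mu ε / 2 * (c.R : ℝ) ^ 2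

/-- The accuracy `ε_s` of stage `s = 1, 2, …`, halved from stage to stage. -/
noncomputable def acc (L ε : ℝ) (s : ℕ) : ℝ := 8 * L / c.mu ε / 2 ^ (s - 1)

/-- The momentum parameter `β_s` of stage `s = 1, 2, …`. -/
noncomputable def beta (L ε : ℝ) (s : ℕ) : ℝ :=
  if s = 1 then 1 / (2 * L) else c.mu ε * c.acc L ε (s - 1) / (64 * L ^ 2)

/-- The learning rate `η_s` of stage `s = 1, 2, …`. -/
noncomputable def eta (L ε : ℝ) (s : ℕ) : ℝ := √(c.beta L ε s / (16 * L ^ 2))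

/-- The number `T_s` of time steps of stage `s = 1, 2, …`. -/
noncomputable def steps (L ε : ℝ) (s : ℕ) : ℕ :=
  if s = 1 then
    max 1 ⌈max (4 * L * c.K * ((c.σf : ℝ) ^ 2 + (c.σJ : ℝ) ^ 2)) (2 * √(2 * L) * c.gap ε)⌉₊
  else
    ⌈max (4 * (64 * L ^ 2) ^ (3 / 2 : ℝ) / (c.mu ε * c.acc L ε (s - 1)))
      (4 * (64 * L ^ 2) / (c.mu ε ^ (3 / 2 : ℝ) * √(c.acc L ε (s - 1))))⌉₊

/-- The number of stages, for the accuracy `ε / 2` of the regularized objective. -/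
noncomputable def stages (L ε : ℝ) : ℕ := ⌈Real.logb 2 (2 * c.acc L ε 1 / (ε / 2))⌉₊

/-- The number of samples of the whole run: one per level and time step. (The first time step of
each later stage reuses the estimates handed over, so this is an upper bound there.) -/
noncomputable def samples (L ε : ℝ) : ℕ :=
  ∑ s ∈ Finset.Icc 1 (c.stages L ε), c.K * c.steps L ε s

end Constants

/-- The point returned by Stage-wise SMVR, with the parameters given by the constants, by `L` and by
the accuracy `ε`, started at `w₀` and run with the samples `ξ` and the random times `τ`. -/
noncomputable def output {Ξ : Type*} [MeasurableSpace Ξ] (c : Constants) (P : Problem c.K Ξ)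
    (L ε : ℝ) (w₀ : Vec (P.d 0)) (ξ : ℕ → ℕ → ℕ → Ξ) (τ : ℕ → ℕ) : Vec (P.d 0) :=
  (P.stagewise c.Lf (c.mu ε) (16 * L ^ 2) (c.eta L ε) w₀ ξ τ (c.stages L ε)).w

end SMVR

/-! Write `G` for the regularized objective, `G*` for its infimum and `V` (`trackErr`) for the sum
of squared errors of all value and Jacobian estimates at their own query points. Three facts drive
the proof.

Tracking. The momentum update turns an old error `e` into `(1 - β) e` plus a term of conditional
mean zero, so second moments add without a cross term. The variance of the new term is controlled by
`β²` times the oracle variance and by the displacement of the query point. Hence one step sends `V`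
to at most `(1 - β)² V + C (η² ‖dir‖² + β² V + β² noise)` in expectation
(`lintegral_trackErr_step_le`). The projection only helps, because the exact Jacobian lies in the
ball.

Descent. Smoothness of `F` gives a decrease of `G` by `η/2 ‖∇G‖² + η/4 ‖dir‖²`, up to `η/2` times
the squared bias of the direction (`reg_step_le`), and this bias is at most a multiple of `V` when
all Jacobian estimates lie in the ball. For the energy `G - G* + V/(4Lη)` the two recursions fit
together: the displacement term is paid by the `η/4 ‖dir‖²`, and the contraction of `V` pays the
bias. What remains is a decrease by `η/2` times the residual `‖∇G‖² + 4 L V`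
(`lintegral_energy_step_le`). Telescoping over a stage and returning a uniform time step bounds the
expected residual at the returned state by `2 E/(η T)` plus small terms, where `E` bounds the
initial expected energy (`lintegral_resid_ret_le`).

Restarting. Convexity of `F` yields `G - G* ≤ ‖∇G‖²/(2μ)` (`reg_sub_iInf_le`), so a small residual
is a small energy for the next stage. By induction the expected residual after stage `s` is at most
`2 μ ε_s`. At the end, `F - F* ≤ ε/2 + residual/(2μ)`, where `ε/2` is the price of the regularizer
at a minimizer of norm at most `D`.

One obstacle remains: the very first Jacobian estimates are not projected, so there the bias is not
bounded by a multiple of `V`. Since a stage may return its first time step, this state can survive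
any number of stages. Its excess error `clipErr` vanishes after any update and has bounded mean, the
samples of different layers being independent; it costs `initCoef / T` per stage.

For the sample count, `T_s` is at most of order `2^s + √2^s/ε`, while `2^S` is of order `1/ε²`; both
geometric sums are of order `1/ε²`.

Expectations are taken in `ℝ≥0∞`, so that no integrability has to be carried along; it follows from
the final bound. -/

namespace SMVR

/-! ### Frobenius geometry and the projection. -/

section Frobenius

variable {m n : ℕ}

/-- The entries of a Jacobian as a Euclidean vector. -/
noncomputable def entries : Jac m n →L[ℝ] EuclideanSpace ℝ (Fin m × Fin n) :=
  LinearMap.toContinuousLinearMap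
    { toFun := fun A => WithLp.toLp 2 fun p => A (EuclideanSpace.single p.1 1) p.2
      map_add' := fun A B => by ext p; simp
      map_smul' := fun r A => by ext p; simp }

theorem entries_apply (A : Jac m n) (p : Fin m × Fin n) :
    entries A p = A (EuclideanSpace.single p.1 1) p.2 := rfl

theorem norm_sq_entries (A : Jac m n) : ‖entries A‖ ^ 2 = frobSq A := by
  rw [EuclideanSpace.norm_sq_eq, Fintype.sum_prod_type]
  simp [frobSq, entries_apply]

theorem frobSq_nonneg (A : Jac m n) : 0 ≤ frobSq A := by
  rw [← norm_sq_entries]; positivity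

theorem continuous_frobSq : Continuous (frobSq : Jac m n → ℝ) := by
  unfold frobSq
  fun_prop

/-- Cauchy–Schwarz in each output coordinate. Stochastic errors live in the Frobenius norm, where
orthogonality is available; the chain rule estimates use the operator norm. -/
theorem norm_le_norm_entries (A : Jac m n) : ‖A‖ ≤ ‖entries A‖ := by
  refine ContinuousLinearMap.opNorm_le_bound _ (norm_nonneg _) fun x => ?_
  have hx : x = ∑ j, x j • EuclideanSpace.single j (1 : ℝ) := by
    ext i
    simp [Pi.single_apply]
  have hA : ∀ k, A x k = ∑ j, x j * entries A (j, k) := by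
    intro k
    conv_lhs => rw [hx]
    simp [entries_apply]
  refine abs_le_of_sq_le_sq' ?_ (by positivity) |>.2
  rw [mul_pow, norm_sq_entries, EuclideanSpace.norm_sq_eq, EuclideanSpace.norm_sq_eq]
  calc ∑ k, ‖A x k‖ ^ 2 = ∑ k, (∑ j, x j * entries A (j, k)) ^ 2 := by
        simp only [hA, Real.norm_eq_abs, sq_abs]
    _ ≤ ∑ k, (∑ j, x j ^ 2) * ∑ j, entries A (j, k) ^ 2 :=
        Finset.sum_le_sum fun k _ => Finset.sum_mul_sq_le_sq_mul_sq _ _ _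
    _ = frobSq A * ∑ j, ‖x j‖ ^ 2 := by
        rw [← Finset.mul_sum, Finset.sum_comm, mul_comm]
        simp [frobSq, entries_apply]

theorem norm_sq_le_frobSq (A : Jac m n) : ‖A‖ ^ 2 ≤ frobSq A := by
  rw [← norm_sq_entries]
  gcongr
  exact norm_le_norm_entries A

theorem norm_proj_le (r : ℝ≥0) (A : Jac m n) : ‖proj r A‖ ≤ r :=
  (exists_proj r A).choose_spec.1

theorem frobSq_proj_sub_self_le (r : ℝ≥0) (A : Jac m n) {B : Jac m n} (hB : ‖B‖ ≤ r) :
    frobSq (proj r A - A) ≤ frobSq (B - A) :=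
  (exists_proj r A).choose_spec.2 B hB

/-- The variational inequality for the nearest point of a convex set, applied to the image of the
operator norm ball in the Hilbert space of entries. -/
theorem inner_entries_proj_le (r : ℝ≥0) (A : Jac m n) {B : Jac m n} (hB : ‖B‖ ≤ r) :
    inner ℝ (entries A - entries (proj r A)) (entries B - entries (proj r A)) ≤ 0 := by
  have hconv : Convex ℝ (entries '' Metric.closedBall (0 : Jac m n) r) :=
    (convex_closedBall _ _).is_linear_image (entries (m := m) (n := n)).isBoundedLinearMap.toIsLinearMap
  have hmem : entries (proj r A) ∈ entries '' Metric.closedBall (0 : Jac m n) r :=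
    ⟨_, by simpa using norm_proj_le r A, rfl⟩
  refine (norm_eq_iInf_iff_real_inner_le_zero hconv hmem).1 ?_ _ ⟨B, by simpa using hB, rfl⟩
  have : Nonempty (entries '' Metric.closedBall (0 : Jac m n) (r : ℝ)) := ⟨⟨_, hmem⟩⟩
  refine le_antisymm (le_ciInf ?_) (ciInf_le ⟨0, ?_⟩ (⟨_, hmem⟩ : entries '' _))
  · rintro ⟨_, B', hB', rfl⟩
    have h := frobSq_proj_sub_self_le r A (B := B') (by simpa using hB')
    rw [← norm_sq_entries, ← norm_sq_entries, map_sub, map_sub, norm_sub_rev,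
      norm_sub_rev (entries B')] at h
    exact abs_le_of_sq_le_sq' h (norm_nonneg _) |>.2
  · rintro _ ⟨_, rfl⟩
    exact norm_nonneg _

/-- With `B` the exact Jacobian, this lets the tracking analysis ignore the projection. -/
theorem frobSq_proj_sub_le (r : ℝ≥0) (A : Jac m n) {B : Jac m n} (hB : ‖B‖ ≤ r) :
    frobSq (proj r A - B) ≤ frobSq (A - B) := by
  have h := inner_entries_proj_le r A hB
  rw [← norm_sq_entries, ← norm_sq_entries, map_sub, map_sub]
  have e : entries A - entries B
      = (entries A - entries (proj r A)) - (entries B - entries (proj r A)) := by abel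
  rw [e, norm_sub_sq_real (entries A - _), norm_sub_rev (entries (proj r A))]
  nlinarith [sq_nonneg ‖entries A - entries (proj r A)‖]

/-- Serves the continuity, hence the measurability, of `proj`, which is defined by choice. -/
theorem norm_entries_proj_sub_le (r : ℝ≥0) (A B : Jac m n) :
    ‖entries (proj r A) - entries (proj r B)‖ ≤ ‖entries A - entries B‖ := by
  have h1 := inner_entries_proj_le r A (norm_proj_le r B)
  have h2 := inner_entries_proj_le r B (norm_proj_le r A)
  set a := entries A
  set b := entries B
  set p := entries (proj r A)
  set q := entries (proj r B)
  -- Sum of the two variational inequalities, each tested with the other projection.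
  have h : ‖p - q‖ ^ 2 ≤ inner ℝ (a - b) (p - q) := by
    rw [← real_inner_self_eq_norm_sq]
    simp only [inner_sub_left, inner_sub_right] at *
    linarith [real_inner_comm p q, real_inner_comm q p]
  have h3 := real_inner_le_norm (a - b) (p - q)
  by_contra hlt
  push Not at hlt
  nlinarith [norm_nonneg (a - b), norm_nonneg (p - q)]

theorem continuous_proj (r : ℝ≥0) : Continuous (proj r : Jac m n → Jac m n) := by
  refine (LipschitzWith.of_dist_le_mul (K := ‖(entries : Jac m n →L[ℝ] _)‖₊) fun A B => ?_).continuous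
  rw [dist_eq_norm, dist_eq_norm]
  calc ‖proj r A - proj r B‖ ≤ ‖entries (proj r A - proj r B)‖ := norm_le_norm_entries _
    _ ≤ ‖entries (A - B)‖ := by
        rw [map_sub, map_sub]; exact norm_entries_proj_sub_le r A B
    _ ≤ _ := ContinuousLinearMap.le_opNorm _ _

end Frobenius

end SMVR

/-! ### Stability of the chain rule under errors in the factors. -/

namespace SMVR

/-- Lipschitz coefficient of the product of `k` factors of norm at most `r`. -/
def chainCoef (r : ℝ) : ℕ → ℝ
  | 0 => 0
  | k + 1 => r ^ k + r * chainCoef r k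

/-- Amplification of the value errors by `k` layers with Lipschitz constant `r`. -/
def valueCoef (r : ℝ) : ℕ → ℝ
  | 0 => 0
  | k + 1 => 1 + r * valueCoef r k

theorem chainCoef_nonneg {r : ℝ} (hr : 0 ≤ r) : ∀ k, 0 ≤ chainCoef r k
  | 0 => le_rfl
  | k + 1 => add_nonneg (pow_nonneg hr k) (mul_nonneg hr (chainCoef_nonneg hr k))

theorem valueCoef_nonneg {r : ℝ} (hr : 0 ≤ r) : ∀ k, 0 ≤ valueCoef r k
  | 0 => le_rfl
  | k + 1 => add_nonneg zero_le_one (mul_nonneg hr (valueCoef_nonneg hr k))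

namespace Constants

variable (c : Constants)

/-- Lipschitz constant of the gradient of the objective. -/
def smoothCoef : ℝ := chainCoef c.Lf c.K * (c.LJ * (1 + c.Lf) ^ c.K)

/-- Ratio of the squared error of the gradient estimate and the squared tracking error. -/
def biasCoef : ℝ :=
  (chainCoef c.Lf c.K * (1 + c.LJ * ∑ j ∈ Finset.range c.K, valueCoef c.Lf j)) ^ 2

theorem smoothCoef_nonneg : 0 ≤ c.smoothCoef :=
  mul_nonneg (chainCoef_nonneg c.Lf.2 _) (by positivity)

theorem biasCoef_nonneg : 0 ≤ c.biasCoef := sq_nonneg _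

end Constants

namespace Problem

section Chain

variable {K : ℕ} {Ξ : Type*} [MeasurableSpace Ξ] (P : Problem K Ξ)

/-- The Jacobians of the layers along the exact composition. -/
noncomputable def exactJac (w : Vec (P.d 0)) (i : ℕ) : Jac (P.d i) (P.d (i + 1)) :=
  P.df i (P.comp i w)

/-- The gradient of the objective. -/
noncomputable def gradF (w : Vec (P.d 0)) : Vec (P.d 0) := P.grad (P.exactJac w)

/-- The regularized objective. -/
noncomputable def reg (μ : ℝ) (w : Vec (P.d 0)) : ℝ := P.F w + μ / 2 * ‖w‖ ^ 2

/-- The gradient of the regularized objective. -/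
noncomputable def gradReg (μ : ℝ) (w : Vec (P.d 0)) : Vec (P.d 0) := P.gradF w + μ • w

/-- The sum of the squared tracking errors of all estimates of a state. -/
noncomputable def trackErr (x : P.State) : ℝ :=
  ∑ i ∈ Finset.range K,
    (‖x.u (i + 1) - P.f i (x.u i)‖ ^ 2 + frobSq (x.v i - P.df i (x.u i)))

theorem trackErr_nonneg (x : P.State) : 0 ≤ P.trackErr x :=
  Finset.sum_nonneg fun _ _ => add_nonneg (sq_nonneg _) (frobSq_nonneg _)

variable {P}

theorem norm_chain_le {r : ℝ} (hr : 0 ≤ r) {v : (i : ℕ) → Jac (P.d i) (P.d (i + 1))} :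
    ∀ k : ℕ, (∀ i < k, ‖v i‖ ≤ r) → ‖P.chain v k‖ ≤ r ^ k
  | 0, _ => by simpa [chain] using ContinuousLinearMap.norm_id_le
  | k + 1, h => by
    rw [pow_succ']
    exact (ContinuousLinearMap.opNorm_comp_le _ _).trans <|
      mul_le_mul (h k k.lt_succ_self) (norm_chain_le hr k fun i hi => h i (hi.trans k.lt_succ_self))
        (norm_nonneg _) hr

/-- Replace one factor at a time: all other factors have norm at most `r`, which is why the Jacobian
estimates are projected. -/
theorem norm_chain_sub_le {r ρ : ℝ} (hr : 0 ≤ r) {v v' : (i : ℕ) → Jac (P.d i) (P.d (i + 1))} :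
    ∀ k : ℕ, (∀ i < k, ‖v i‖ ≤ r) → (∀ i < k, ‖v' i‖ ≤ r) → (∀ i < k, ‖v i - v' i‖ ≤ ρ) →
      ‖P.chain v k - P.chain v' k‖ ≤ chainCoef r k * ρ
  | 0, _, _, _ => by simp [chain, chainCoef]
  | k + 1, h, h', hd => by
    have ih := norm_chain_sub_le hr (v := v) (v' := v') k
      (fun i hi => h i (hi.trans k.lt_succ_self))
      (fun i hi => h' i (hi.trans k.lt_succ_self)) (fun i hi => hd i (hi.trans k.lt_succ_self))
    have e : P.chain v (k + 1) - P.chain v' (k + 1)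
        = (v k - v' k).comp (P.chain v k) + (v' k).comp (P.chain v k - P.chain v' k) := by
      ext x
      simp [chain]
    have h1 : ‖(v k - v' k).comp (P.chain v k)‖ ≤ ρ * r ^ k :=
      (ContinuousLinearMap.opNorm_comp_le _ _).trans <|
        mul_le_mul (hd k k.lt_succ_self)
          (norm_chain_le hr k fun i hi => h i (hi.trans k.lt_succ_self)) (norm_nonneg _)
          ((norm_nonneg _).trans (hd k k.lt_succ_self))
    have h2 : ‖(v' k).comp (P.chain v k - P.chain v' k)‖ ≤ r * (chainCoef r k * ρ) :=
      (ContinuousLinearMap.opNorm_comp_le _ _).trans <|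
        mul_le_mul (h' k k.lt_succ_self) ih (norm_nonneg _) hr
    rw [e, chainCoef]
    refine (norm_add_le _ _).trans ?_
    linarith

theorem norm_grad_sub_le (v v' : (i : ℕ) → Jac (P.d i) (P.d (i + 1))) :
    ‖P.grad v - P.grad v'‖ ≤ ‖P.chain v K - P.chain v' K‖ := by
  rw [grad, grad, ← sub_apply, ← map_sub]
  refine (ContinuousLinearMap.le_opNorm _ _).trans ?_
  rw [LinearIsometryEquiv.norm_map]
  simp

theorem inner_grad (v : (i : ℕ) → Jac (P.d i) (P.d (i + 1))) (y : Vec (P.d 0)) :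
    inner ℝ (P.grad v) y = P.chain v K y P.last := by
  rw [grad, ContinuousLinearMap.adjoint_inner_left, EuclideanSpace.inner_single_left]
  simp

end Chain

/-! ### Smoothness, descent and convexity of the objective; bias of the gradient estimate. -/

section Objective

variable {c : Constants} {Ξ : Type*} [MeasurableSpace Ξ] {P : Problem c.K Ξ}

theorem Assumptions.norm_df_le (H : P.Assumptions c) {i : ℕ} (hi : i < c.K) (x : Vec (P.d i)) :
    ‖P.df i x‖ ≤ c.Lf :=
  norm_fderiv_le_of_lipschitz ℝ (H.f_lip i hi)

theorem Assumptions.norm_f_sub_le (H : P.Assumptions c) {i : ℕ} (hi : i < c.K)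
    (x y : Vec (P.d i)) : ‖P.f i x - P.f i y‖ ≤ c.Lf * ‖x - y‖ := by
  simpa [dist_eq_norm] using (H.f_lip i hi).dist_le_mul x y

theorem Assumptions.norm_df_sub_le (H : P.Assumptions c) {i : ℕ} (hi : i < c.K)
    (x y : Vec (P.d i)) : ‖P.df i x - P.df i y‖ ≤ c.LJ * ‖x - y‖ := by
  simpa [dist_eq_norm] using (H.df_lip i hi).dist_le_mul x y

theorem Assumptions.norm_comp_sub_le (H : P.Assumptions c) (w w' : Vec (P.d 0)) :
    ∀ k ≤ c.K, ‖P.comp k w - P.comp k w'‖ ≤ (c.Lf : ℝ) ^ k * ‖w - w'‖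
  | 0, _ => by simp [comp]
  | k + 1, hk => by
    refine (H.norm_f_sub_le hk _ _).trans ?_
    rw [pow_succ', mul_assoc]
    exact mul_le_mul_of_nonneg_left (H.norm_comp_sub_le w w' k (Nat.le_of_succ_le hk)) c.Lf.2

theorem Assumptions.hasFDerivAt_comp (H : P.Assumptions c) (w : Vec (P.d 0)) :
    ∀ k ≤ c.K, HasFDerivAt (P.comp k) (P.chain (P.exactJac w) k) w
  | 0, _ => hasFDerivAt_id w
  | k + 1, hk =>
    ((H.f_diff k hk (P.comp k w)).hasFDerivAt).comp w
      (H.hasFDerivAt_comp w k (Nat.le_of_succ_le hk))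

theorem Assumptions.hasFDerivAt_F (H : P.Assumptions c) (w : Vec (P.d 0)) :
    HasFDerivAt P.F (innerSL ℝ (P.gradF w)) w := by
  have h := (EuclideanSpace.proj (𝕜 := ℝ) (P.last)).hasFDerivAt.comp w
    (H.hasFDerivAt_comp w c.K le_rfl)
  refine h.congr_fderiv ?_
  ext y
  simp [gradF, inner_grad]

theorem Assumptions.continuous_F (H : P.Assumptions c) : Continuous P.F :=
  continuous_iff_continuousAt.2 fun w => (H.hasFDerivAt_F w).continuousAt

theorem Assumptions.norm_gradF_sub_le (H : P.Assumptions c) (w w' : Vec (P.d 0)) :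
    ‖P.gradF w - P.gradF w'‖ ≤ c.smoothCoef * ‖w - w'‖ := by
  refine (norm_grad_sub_le _ _).trans ?_
  rw [Constants.smoothCoef, mul_assoc]
  refine norm_chain_sub_le c.Lf.2 c.K (fun i hi => H.norm_df_le hi _)
    (fun i hi => H.norm_df_le hi _) fun i hi => (H.norm_df_sub_le hi _ _).trans ?_
  rw [mul_assoc]
  refine mul_le_mul_of_nonneg_left ((H.norm_comp_sub_le w w' i hi.le).trans ?_) c.LJ.2
  refine mul_le_mul_of_nonneg_right ?_ (norm_nonneg _)
  -- `Lf` may be smaller than 1; the base `1 + Lf` makes one bound valid for all levels.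
  have h0 : (0 : ℝ) ≤ c.Lf := c.Lf.2
  calc (c.Lf : ℝ) ^ i ≤ (1 + c.Lf) ^ i := by gcongr; linarith
    _ ≤ (1 + c.Lf) ^ c.K := pow_le_pow_right₀ (by linarith) hi.le

/-- The mean value inequality for `F` minus its linearization at `x`. It loses the usual factor
`1/2`, which only affects constants. -/
theorem Assumptions.F_le_quadratic (H : P.Assumptions c) (x y : Vec (P.d 0)) :
    P.F y ≤ P.F x + inner ℝ (P.gradF x) (y - x) + c.smoothCoef * ‖y - x‖ ^ 2 := by
  have h := Convex.norm_image_sub_le_of_norm_hasFDerivWithin_le' (𝕜 := ℝ) (f := P.F)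
    (f' := fun z => innerSL ℝ (P.gradF z)) (φ := innerSL ℝ (P.gradF x))
    (s := segment ℝ x y) (C := c.smoothCoef * ‖y - x‖)
    (fun z _ => (H.hasFDerivAt_F z).hasFDerivWithinAt) (fun z hz => ?_) (convex_segment x y)
    (left_mem_segment ℝ x y) (right_mem_segment ℝ x y)
  · have h2 := (le_abs_self _).trans h
    rw [innerSL_apply_apply] at h2
    nlinarith
  · rw [← map_sub, innerSL_apply_norm]
    refine (H.norm_gradF_sub_le z x).trans (mul_le_mul_of_nonneg_left ?_ c.smoothCoef_nonneg)
    have := norm_sub_le_of_mem_segment hz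
    simpa using this

/-- Polarize `-η ⟨∇G, h⟩` into the three squares; half of the resulting `-η/2 ‖h‖²` absorbs the
quadratic remainder. The other half is kept to pay for the displacement in the tracking recursion.
-/
theorem Assumptions.reg_step_le (H : P.Assumptions c) {μ η : ℝ} (hμ : 0 ≤ μ) (hη : 0 ≤ η)
    (hs : η * (c.smoothCoef + μ) ≤ 1 / 4) (w h : Vec (P.d 0)) :
    P.reg μ (w - η • h) ≤ P.reg μ w - η / 2 * ‖P.gradReg μ w‖ ^ 2 - η / 4 * ‖h‖ ^ 2
      + η / 2 * ‖h - P.gradReg μ w‖ ^ 2 := by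
  have h1 := H.F_le_quadratic w (w - η • h)
  have e : w - η • h - w = -(η • h) := by abel
  rw [e, inner_neg_right, inner_smul_right, norm_neg, norm_smul, Real.norm_eq_abs,
    abs_of_nonneg hη, mul_pow] at h1
  have h2 : ‖w - η • h‖ ^ 2 = ‖w‖ ^ 2 - 2 * (η * inner ℝ w h) + η ^ 2 * ‖h‖ ^ 2 := by
    rw [norm_sub_sq_real, inner_smul_right, norm_smul, Real.norm_eq_abs, abs_of_nonneg hη, mul_pow]
  have h3 : ‖h - P.gradReg μ w‖ ^ 2
      = ‖h‖ ^ 2 - 2 * (inner ℝ (P.gradF w) h + μ * inner ℝ w h) + ‖P.gradReg μ w‖ ^ 2 := by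
    rw [norm_sub_sq_real, real_inner_comm]
    simp [gradReg, inner_add_left, inner_smul_left]
  rw [h3, reg, reg, h2]
  have h4 := mul_le_mul_of_nonneg_right hs (mul_nonneg hη (sq_nonneg ‖h‖))
  nlinarith [mul_nonneg hμ (mul_nonneg (sq_nonneg η) (sq_nonneg ‖h‖))]

theorem Assumptions.F_ge_linear (H : P.Assumptions c) (hc : ConvexOn ℝ Set.univ P.F)
    (x y : Vec (P.d 0)) : P.F x + inner ℝ (P.gradF x) (y - x) ≤ P.F y := by
  have hl : ConvexOn ℝ Set.univ (fun t : ℝ => P.F (AffineMap.lineMap x y t)) :=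
    hc.comp_affineMap (AffineMap.lineMap x y)
  have hd : HasDerivAt (fun t : ℝ => P.F (AffineMap.lineMap x y t))
      (inner ℝ (P.gradF x) (y - x)) 0 := by
    have h0 := H.hasFDerivAt_F (AffineMap.lineMap x y (0 : ℝ))
    have := h0.comp_hasDerivAt (0 : ℝ) (AffineMap.hasDerivAt_lineMap (a := x) (b := y))
    simpa [Function.comp_def] using this
  have := hl.le_slope_of_hasDerivAt (Set.mem_univ 0) (Set.mem_univ 1) zero_lt_one hd
  simp [slope_def_field] at this
  linarith

/-- The Polyak–Łojasiewicz inequality: by convexity of `F`, `G` lies above a quadratic with leading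
coefficient `μ/2`, whose minimum is explicit. -/
theorem Assumptions.reg_sub_iInf_le (H : P.Assumptions c) (hc : ConvexOn ℝ Set.univ P.F)
    {μ : ℝ} (hμ : 0 < μ) (x : Vec (P.d 0)) :
    P.reg μ x - ⨅ w, P.reg μ w ≤ ‖P.gradReg μ x‖ ^ 2 / (2 * μ) := by
  suffices h : P.reg μ x - ‖P.gradReg μ x‖ ^ 2 / (2 * μ) ≤ ⨅ w, P.reg μ w by linarith
  refine le_ciInf fun y => ?_
  have h1 := H.F_ge_linear hc x y
  have h2 : ‖y‖ ^ 2 = ‖x‖ ^ 2 + 2 * inner ℝ x (y - x) + ‖y - x‖ ^ 2 := by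
    conv_lhs => rw [← add_sub_cancel x y]
    rw [norm_add_sq_real]
  -- Completing the square: this is `‖∇G(x) + μ (y - x)‖²`.
  have h3 : 0 ≤ ‖P.gradReg μ x‖ ^ 2 + 2 * μ * inner ℝ (P.gradReg μ x) (y - x)
      + μ ^ 2 * ‖y - x‖ ^ 2 := by
    have := sq_nonneg ‖P.gradReg μ x + μ • (y - x)‖
    rw [norm_add_sq_real, inner_smul_right, norm_smul, mul_pow, Real.norm_eq_abs, sq_abs] at this
    linarith
  have h4 : inner ℝ (P.gradReg μ x) (y - x)
      = inner ℝ (P.gradF x) (y - x) + μ * inner ℝ x (y - x) := by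
    simp [gradReg, inner_add_left, inner_smul_left]
  rw [h4] at h3
  have h5 : 0 ≤ ‖P.gradReg μ x‖ ^ 2 / (2 * μ) + inner ℝ (P.gradF x) (y - x)
      + μ * inner ℝ x (y - x) + μ / 2 * ‖y - x‖ ^ 2 := by
    have := div_nonneg h3 (by positivity : 0 ≤ 2 * μ)
    refine this.trans_eq ?_
    have := hμ.ne'
    field_simp
    ring
  rw [reg, reg, h2]
  linarith

theorem bddBelow_F {x : Vec (P.d 0)} (hx : IsMinOn P.F Set.univ x) :
    BddBelow (Set.range P.F) :=
  ⟨P.F x, by rintro _ ⟨y, rfl⟩; exact hx (Set.mem_univ y)⟩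

theorem iInf_F_eq {x : Vec (P.d 0)} (hx : IsMinOn P.F Set.univ x) : ⨅ w, P.F w = P.F x :=
  le_antisymm (ciInf_le (bddBelow_F hx) x) (le_ciInf fun y => hx (Set.mem_univ y))

theorem bddBelow_reg {μ : ℝ} (hμ : 0 ≤ μ) {x : Vec (P.d 0)} (hx : IsMinOn P.F Set.univ x) :
    BddBelow (Set.range (P.reg μ)) := by
  refine ⟨P.F x, ?_⟩
  rintro _ ⟨y, rfl⟩
  have : P.F x ≤ P.F y := hx (Set.mem_univ y)
  have h2 : 0 ≤ μ / 2 * ‖y‖ ^ 2 := by positivity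
  rw [reg]
  linarith

theorem iInf_F_le_iInf_reg {μ : ℝ} (hμ : 0 ≤ μ) {x : Vec (P.d 0)} (hx : IsMinOn P.F Set.univ x) :
    ⨅ w, P.F w ≤ ⨅ w, P.reg μ w := by
  refine le_ciInf fun y => (ciInf_le (bddBelow_F hx) y).trans ?_
  have h2 : 0 ≤ μ / 2 * ‖y‖ ^ 2 := by positivity
  rw [reg]
  linarith

/-- Each level adds its own tracking error and amplifies the accumulated one by `Lf`. -/
theorem Assumptions.norm_u_sub_comp_le (H : P.Assumptions c) (x : P.State) :
    ∀ k ≤ c.K, ‖x.u k - P.comp k x.w‖ ≤ valueCoef c.Lf k * √(P.trackErr x)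
  | 0, _ => by simp [comp, State.w, valueCoef]
  | k + 1, hk => by
    have ih := H.norm_u_sub_comp_le x k (Nat.le_of_succ_le hk)
    have h1 : ‖x.u (k + 1) - P.f k (x.u k)‖ ≤ √(P.trackErr x) := by
      refine Real.le_sqrt_of_sq_le ?_
      refine le_trans ?_ (Finset.single_le_sum (f := fun i => ‖x.u (i + 1) - P.f i (x.u i)‖ ^ 2
        + frobSq (x.v i - P.df i (x.u i)))
        (fun _ _ => add_nonneg (sq_nonneg _) (frobSq_nonneg _)) (Finset.mem_range.2 hk))
      exact le_add_of_nonneg_right (frobSq_nonneg _)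
    have h2 := (H.norm_f_sub_le hk (x.u k) (P.comp k x.w)).trans
      (mul_le_mul_of_nonneg_left ih c.Lf.2)
    have e : x.u (k + 1) - P.comp (k + 1) x.w
        = (x.u (k + 1) - P.f k (x.u k)) + (P.f k (x.u k) - P.f k (P.comp k x.w)) := by
      rw [comp]; abel
    rw [e, valueCoef]
    refine (norm_add_le _ _).trans ?_
    linarith

/-- A Jacobian estimate is off by its tracking error and because it is taken at `u i` rather than at
the exact composition; both are multiples of `√V`. -/
theorem Assumptions.norm_sq_grad_sub_gradF_le (H : P.Assumptions c) (x : P.State)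
    (hx : ∀ i < c.K, ‖x.v i‖ ≤ c.Lf) :
    ‖P.grad x.v - P.gradF x.w‖ ^ 2 ≤ c.biasCoef * P.trackErr x := by
  have hs : 0 ≤ √(P.trackErr x) := Real.sqrt_nonneg _
  have h : ‖P.grad x.v - P.gradF x.w‖
      ≤ chainCoef c.Lf c.K * (1 + c.LJ * ∑ j ∈ Finset.range c.K, valueCoef c.Lf j)
        * √(P.trackErr x) := by
    refine (norm_grad_sub_le _ _).trans ?_
    rw [mul_assoc]
    refine norm_chain_sub_le c.Lf.2 c.K hx (fun i hi => H.norm_df_le hi _) fun i hi => ?_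
    have h1 : ‖x.v i - P.df i (x.u i)‖ ≤ √(P.trackErr x) := by
      refine Real.le_sqrt_of_sq_le ((norm_sq_le_frobSq _).trans ?_)
      refine le_trans ?_ (Finset.single_le_sum (f := fun i => ‖x.u (i + 1) - P.f i (x.u i)‖ ^ 2
        + frobSq (x.v i - P.df i (x.u i)))
        (fun _ _ => add_nonneg (sq_nonneg _) (frobSq_nonneg _)) (Finset.mem_range.2 hi))
      exact le_add_of_nonneg_left (sq_nonneg _)
    have h2 := (H.norm_df_sub_le hi (x.u i) (P.comp i x.w)).trans
      (mul_le_mul_of_nonneg_left (H.norm_u_sub_comp_le x i hi.le) c.LJ.2)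
    have h3 : valueCoef c.Lf i ≤ ∑ j ∈ Finset.range c.K, valueCoef c.Lf j :=
      Finset.single_le_sum (fun j _ => valueCoef_nonneg c.Lf.2 j) (Finset.mem_range.2 hi)
    have h4 := mul_le_mul_of_nonneg_right (mul_le_mul_of_nonneg_left h3 c.LJ.2) hs
    have e : x.v i - P.exactJac x.w i
        = (x.v i - P.df i (x.u i)) + (P.df i (x.u i) - P.df i (P.comp i x.w)) := by
      rw [exactJac]; abel
    rw [e]
    refine (norm_add_le _ _).trans ?_
    have h5 : (c.LJ : ℝ) * (valueCoef c.Lf i * √(P.trackErr x))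
        ≤ c.LJ * (∑ j ∈ Finset.range c.K, valueCoef c.Lf j) * √(P.trackErr x) := by
      rw [← mul_assoc]; exact h4
    linarith
  calc ‖P.grad x.v - P.gradF x.w‖ ^ 2 ≤ (_ * √(P.trackErr x)) ^ 2 := by gcongr
    _ = c.biasCoef * P.trackErr x := by
      rw [mul_pow, Real.sq_sqrt (P.trackErr_nonneg x), Constants.biasCoef]

end Objective

end Problem

end SMVR

/-! ### Measurability of states and updates. -/

namespace SMVR

namespace Problem

section StateSpace

variable {K : ℕ} {Ξ : Type*} [MeasurableSpace Ξ] (P : Problem K Ξ)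

/-- The σ-algebra on the states generated by the estimates of the `K` layers. -/
noncomputable instance instMeasurableSpaceState : MeasurableSpace P.State :=
  MeasurableSpace.comap
    (fun x => ((fun i : Fin (K + 1) => x.u i, fun i : Fin K => x.v i) :
      ((i : Fin (K + 1)) → Vec (P.d i)) × ((i : Fin K) → Jac (P.d i) (P.d (i + 1)))))
    inferInstance

variable {P}

theorem measurable_u {i : ℕ} (hi : i ≤ K) : Measurable fun x : P.State => x.u i := by
  have h : Measurable fun x : P.State => ((fun i : Fin (K + 1) => x.u i, fun i : Fin K => x.v i) :
      ((i : Fin (K + 1)) → Vec (P.d i)) × ((i : Fin K) → Jac (P.d i) (P.d (i + 1)))) :=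
    comap_measurable _
  exact (measurable_pi_apply (⟨i, Nat.lt_succ_of_le hi⟩ : Fin (K + 1))).comp h.fst

theorem measurable_v {i : ℕ} (hi : i < K) : Measurable fun x : P.State => x.v i := by
  have h : Measurable fun x : P.State => ((fun i : Fin (K + 1) => x.u i, fun i : Fin K => x.v i) :
      ((i : Fin (K + 1)) → Vec (P.d i)) × ((i : Fin K) → Jac (P.d i) (P.d (i + 1)))) :=
    comap_measurable _
  exact (measurable_pi_apply (⟨i, hi⟩ : Fin K)).comp h.snd

/-- Only finitely many components matter for the σ-algebra; the layers from `K` on need not be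
measurable. -/
theorem measurable_state {α : Type*} [MeasurableSpace α] {X : α → P.State}
    (hu : ∀ i ≤ K, Measurable fun a => (X a).u i) (hv : ∀ i < K, Measurable fun a => (X a).v i) :
    Measurable X :=
  measurable_comap_iff.2 <|
    (measurable_pi_lambda _ fun i : Fin (K + 1) => hu i (Nat.le_of_lt_succ i.2)).prodMk
      (measurable_pi_lambda _ fun i : Fin K => hv i i.2)

theorem measurable_w : Measurable fun x : P.State => x.w := measurable_u (Nat.zero_le K)

theorem measurable_chain {α : Type*} [MeasurableSpace α]
    {v : α → (i : ℕ) → Jac (P.d i) (P.d (i + 1))} :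
    ∀ k : ℕ, (∀ i < k, Measurable fun a => v a i) → Measurable fun a => P.chain (v a) k
  | 0, _ => measurable_const
  | k + 1, h => by
    have ih := measurable_chain k fun i hi => h i (hi.trans k.lt_succ_self)
    have hc : Continuous fun p : Jac (P.d k) (P.d (k + 1)) × Jac (P.d 0) (P.d k) =>
      p.1.comp p.2 := by fun_prop
    exact hc.measurable.comp ((h k k.lt_succ_self).prodMk ih)

theorem measurable_grad : Measurable fun x : P.State => P.grad x.v := by
  have hc : Continuous fun A : Jac (P.d 0) (P.d K) =>
      ContinuousLinearMap.adjoint A (EuclideanSpace.single P.last (1 : ℝ)) := by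
    have : Continuous fun A : Jac (P.d 0) (P.d K) => ContinuousLinearMap.adjoint A :=
      LinearIsometryEquiv.continuous _
    fun_prop
  exact hc.measurable.comp (measurable_chain K fun i hi => measurable_v hi)

theorem measurable_nextW (μ η : ℝ) : Measurable fun x : P.State => P.nextW μ η x := by
  have := measurable_grad (P := P)
  have := measurable_w (P := P)
  unfold nextW
  fun_prop

end StateSpace

section Oracle

variable {c : Constants} {Ξ : Type*} [MeasurableSpace Ξ] {P : Problem c.K Ξ}

theorem Assumptions.measurable_f (H : P.Assumptions c) {i : ℕ} (hi : i < c.K) :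
    Measurable (P.f i) := (H.f_lip i hi).continuous.measurable

theorem Assumptions.measurable_df (H : P.Assumptions c) {i : ℕ} (hi : i < c.K) :
    Measurable (P.df i) := (H.df_lip i hi).continuous.measurable

theorem Assumptions.measurable_trackErr (H : P.Assumptions c) : Measurable P.trackErr := by
  unfold trackErr
  refine Finset.measurable_fun_sum _ fun i hi => ?_
  have hi := Finset.mem_range.1 hi
  have h1 := measurable_u (P := P) (i := i + 1) hi
  have h2 := measurable_u (P := P) (i := i) hi.le
  have h3 := measurable_v (P := P) hi
  have h4 := (H.measurable_f hi).comp h2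
  have h5 := (H.measurable_df hi).comp h2
  exact ((h1.sub h4).norm.pow_const 2).add (continuous_frobSq.measurable.comp (h3.sub h5))

theorem Assumptions.continuous_gradF (H : P.Assumptions c) : Continuous P.gradF :=
  (LipschitzWith.of_dist_le_mul (K := ⟨c.smoothCoef, c.smoothCoef_nonneg⟩) fun x y => by
    rw [dist_eq_norm, dist_eq_norm]; exact H.norm_gradF_sub_le x y).continuous

theorem Assumptions.measurable_reg (H : P.Assumptions c) (μ : ℝ) : Measurable (P.reg μ) := by
  have := H.continuous_F
  unfold reg
  exact (by fun_prop : Continuous fun w => P.F w + μ / 2 * ‖w‖ ^ 2).measurable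

theorem Assumptions.measurable_gradReg (H : P.Assumptions c) (μ : ℝ) :
    Measurable (P.gradReg μ) := by
  have := H.continuous_gradF
  unfold gradReg
  exact (by fun_prop : Continuous fun w => P.gradF w + μ • w).measurable

theorem Assumptions.measurable_initU (H : P.Assumptions c) (w : Vec (P.d 0)) {α : Type*}
    [MeasurableSpace α] {Z : α → ℕ → Ξ} :
    ∀ k ≤ c.K, (∀ j < k, Measurable fun a => Z a j) → Measurable fun a => P.initU w (Z a) k
  | 0, _, _ => measurable_const
  | k + 1, hk, hZ =>
    (H.g_meas k hk).comp ((H.measurable_initU w k (Nat.le_of_succ_le hk)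
      fun j hj => hZ j (hj.trans k.lt_succ_self)).prodMk (hZ k k.lt_succ_self))

theorem Assumptions.measurable_initState (H : P.Assumptions c) (w : Vec (P.d 0)) {α : Type*}
    [MeasurableSpace α] {Z : α → ℕ → Ξ} (hZ : ∀ j, Measurable fun a => Z a j) :
    Measurable fun a => P.initState w (Z a) :=
  measurable_state (fun i hi => H.measurable_initU w i hi fun j _ => hZ j) fun i hi =>
    (H.dg_meas i hi).comp ((H.measurable_initU w i hi.le fun j _ => hZ j).prodMk (hZ i))

theorem Assumptions.measurable_nextU (H : P.Assumptions c) (μ η β : ℝ) {α : Type*}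
    [MeasurableSpace α] {X : α → P.State} {Z : α → ℕ → Ξ} (hX : Measurable X) :
    ∀ k ≤ c.K, (∀ j < k, Measurable fun a => Z a j) →
      Measurable fun a => P.nextU μ η β (X a) (Z a) k
  | 0, _, _ => (measurable_nextW μ η).comp hX
  | k + 1, hk, hZ => by
    have h1 := H.measurable_nextU μ η β hX k (Nat.le_of_succ_le hk)
      fun j hj => hZ j (hj.trans k.lt_succ_self)
    have h2 := (H.g_meas k hk).comp (h1.prodMk (hZ k k.lt_succ_self))
    have h3 := (H.g_meas k hk).comp
      (((measurable_u (P := P) (Nat.le_of_succ_le hk)).comp hX).prodMk (hZ k k.lt_succ_self))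
    have h4 := (measurable_u (P := P) hk).comp hX
    exact ((h4.const_smul (1 - β)).add (h2.const_smul β)).add ((h2.sub h3).const_smul (1 - β))

theorem Assumptions.measurable_step (H : P.Assumptions c) (Lf : ℝ≥0) (μ η β : ℝ) {α : Type*}
    [MeasurableSpace α] {X : α → P.State} {Z : α → ℕ → Ξ} (hX : Measurable X)
    (hZ : ∀ j, Measurable fun a => Z a j) :
    Measurable fun a => P.step Lf μ η β (X a) (Z a) := by
  refine measurable_state (fun i hi => H.measurable_nextU μ η β hX i hi fun j _ => hZ j)
    fun i hi => ?_
  have h1 := H.measurable_nextU μ η β hX i hi.le fun j _ => hZ j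
  have h2 := (H.dg_meas i hi).comp (h1.prodMk (hZ i))
  have h3 := (H.dg_meas i hi).comp (((measurable_u (P := P) hi.le).comp hX).prodMk (hZ i))
  have h4 := (measurable_v (P := P) hi).comp hX
  exact (continuous_proj Lf).measurable.comp
    (((h4.const_smul (1 - β)).add (h2.const_smul β)).add ((h2.sub h3).const_smul (1 - β)))

theorem Assumptions.measurable_smvr (H : P.Assumptions c) (Lf : ℝ≥0) (μ a η : ℝ) {α : Type*}
    [MeasurableSpace α] {X : α → P.State} {Z : α → ℕ → ℕ → Ξ} (hX : Measurable X) :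
    ∀ n : ℕ, (∀ m < n, ∀ j, Measurable fun a => Z a m j) →
      Measurable fun b => P.smvr Lf μ a η (X b) (Z b) n
  | 0, _ => hX
  | n + 1, hZ =>
    H.measurable_step Lf μ η (a * η ^ 2)
      (H.measurable_smvr Lf μ a η hX n fun m hm => hZ m (hm.trans n.lt_succ_self))
      (hZ n n.lt_succ_self)

theorem Assumptions.measurable_stagewise (H : P.Assumptions c) (Lf : ℝ≥0) (μ a : ℝ) (η : ℕ → ℝ)
    (w : Vec (P.d 0)) {α : Type*} [MeasurableSpace α] {ξ : α → ℕ → ℕ → ℕ → Ξ} {τ : α → ℕ → ℕ} :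
    ∀ s : ℕ, (∀ r ≤ s, ∀ n j, Measurable fun b => ξ b r n j) →
      (∀ r ≤ s, Measurable fun b => τ b r) →
      Measurable fun b => P.stagewise Lf μ a η w (ξ b) (τ b) s
  | 0, hξ, _ => H.measurable_initState w fun j => hξ 0 le_rfl 0 j
  | s + 1, hξ, hτ => by
    have ih := H.measurable_stagewise Lf μ a η w s (fun r hr => hξ r (Nat.le_succ_of_le hr))
      fun r hr => hτ r (Nat.le_succ_of_le hr)
    -- The random time takes countably many values, so measurability at each fixed time suffices.
    have h : Measurable fun p : ℕ × α =>
        P.smvr Lf μ a (η (s + 1)) (P.stagewise Lf μ a η w (ξ p.2) (τ p.2) s) (ξ p.2 (s + 1)) p.1 :=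
      measurable_from_prod_countable_right fun n =>
        H.measurable_smvr Lf μ a (η (s + 1)) ih n fun m _ j => hξ (s + 1) le_rfl m j
    exact h.comp ((hτ (s + 1) le_rfl).prodMk measurable_id)

end Oracle

end Problem

end SMVR

namespace SMVR

/-! ### Second moments of the momentum estimates. -/

section Moments

theorem norm_add_sq_le_two {H : Type*} [NormedAddCommGroup H] [InnerProductSpace ℝ H] (a b : H) : ‖a + b‖ ^ 2 ≤ 2 * ‖a‖ ^ 2 + 2 * ‖b‖ ^ 2 := by
  have h := parallelogram_law_with_norm ℝ a b
  nlinarith [sq_nonneg ‖a - b‖]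

theorem norm_add_sq_le_three {H : Type*} [NormedAddCommGroup H] (a b d : H) :
    ‖a + b + d‖ ^ 2 ≤ 3 * ‖a‖ ^ 2 + 3 * ‖b‖ ^ 2 + 3 * ‖d‖ ^ 2 := by
  have h := norm_add_le (a + b) d
  have h' := norm_add_le a b
  have h2 : ‖a + b + d‖ ≤ ‖a‖ + ‖b‖ + ‖d‖ := by linarith
  have h3 := pow_le_pow_left₀ (norm_nonneg _) h2 2
  nlinarith [sq_nonneg (‖a‖ - ‖b‖), sq_nonneg (‖a‖ - ‖d‖), sq_nonneg (‖b‖ - ‖d‖)]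

variable {Ξ : Type*} [MeasurableSpace Ξ] {ν : Measure Ξ} [IsProbabilityMeasure ν]
  {H : Type*} [NormedAddCommGroup H] [InnerProductSpace ℝ H]

theorem integrable_norm_add_sq {N : Ξ → H} (hN : Integrable N ν)
    (hN2 : Integrable (fun z => ‖N z‖ ^ 2) ν) (b : H) :
    Integrable (fun z => ‖b + N z‖ ^ 2) ν := by
  simp only [norm_add_sq_real]
  exact ((integrable_const _).add ((hN.const_inner b).const_mul 2)).add hN2

variable {a b : Ξ → H} {A B : H} {σ2 l2 β : ℝ}

/-- The second moment of the change of the momentum estimate. -/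
theorem lintegral_momentum_move_le (hv : Integrable (fun z => ‖b z - B‖ ^ 2) ν)
    (hv' : ∫ z, ‖b z - B‖ ^ 2 ∂ν ≤ σ2)
    (hl : Integrable (fun z => ‖a z - b z‖ ^ 2) ν) (hl' : ∫ z, ‖a z - b z‖ ^ 2 ∂ν ≤ l2) (q : H) :
    ∫⁻ z, ENNReal.ofReal (‖(1 - β) • q + β • a z + (1 - β) • (a z - b z) - q‖ ^ 2) ∂ν
      ≤ ENNReal.ofReal (3 * β ^ 2 * ‖q - B‖ ^ 2 + 3 * β ^ 2 * σ2 + 3 * l2) := by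
  have iR : Integrable (fun z => 3 * β ^ 2 * ‖q - B‖ ^ 2 + 3 * β ^ 2 * ‖b z - B‖ ^ 2
      + 3 * ‖a z - b z‖ ^ 2) ν :=
    ((integrable_const _).add (hv.const_mul _)).add (hl.const_mul _)
  calc ∫⁻ z, ENNReal.ofReal (‖(1 - β) • q + β • a z + (1 - β) • (a z - b z) - q‖ ^ 2) ∂ν
      ≤ ∫⁻ z, ENNReal.ofReal (3 * β ^ 2 * ‖q - B‖ ^ 2 + 3 * β ^ 2 * ‖b z - B‖ ^ 2
          + 3 * ‖a z - b z‖ ^ 2) ∂ν := by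
        refine lintegral_mono fun z => ENNReal.ofReal_le_ofReal ?_
        have e : (1 - β) • q + β • a z + (1 - β) • (a z - b z) - q
            = β • (B - q) + β • (b z - B) + (a z - b z) := by module
        rw [e]
        refine (norm_add_sq_le_three _ _ _).trans (le_of_eq ?_)
        rw [norm_smul, norm_smul, mul_pow, mul_pow, Real.norm_eq_abs, sq_abs, norm_sub_rev B q]
        ring
    _ = ENNReal.ofReal (∫ z, (3 * β ^ 2 * ‖q - B‖ ^ 2 + 3 * β ^ 2 * ‖b z - B‖ ^ 2
          + 3 * ‖a z - b z‖ ^ 2) ∂ν) :=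
        (ofReal_integral_eq_lintegral_ofReal iR (.of_forall fun z => by positivity)).symm
    _ ≤ _ := by
        refine ENNReal.ofReal_le_ofReal ?_
        have i1 : Integrable (fun z => 3 * β ^ 2 * ‖q - B‖ ^ 2 + 3 * β ^ 2 * ‖b z - B‖ ^ 2) ν :=
          (integrable_const _).add (hv.const_mul _)
        rw [integral_add i1 (hl.const_mul _), integral_add (integrable_const _) (hv.const_mul _),
          integral_const, integral_const_mul, integral_const_mul]
        have h6 := mul_le_mul_of_nonneg_left hv' (by positivity : 0 ≤ 3 * β ^ 2)
        simp only [probReal_univ, smul_eq_mul, one_mul]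
        linarith

variable [CompleteSpace H]

/-- The cross term has mean zero. This orthogonality is what keeps the contraction factor of the old
error free of a further constant. -/
theorem integral_norm_add_sq {N : Ξ → H} (hN : Integrable N ν)
    (hN2 : Integrable (fun z => ‖N z‖ ^ 2) ν) (h0 : ∫ z, N z ∂ν = 0) (b : H) :
    ∫ z, ‖b + N z‖ ^ 2 ∂ν = ‖b‖ ^ 2 + ∫ z, ‖N z‖ ^ 2 ∂ν := by
  simp only [norm_add_sq_real]
  have h1 : Integrable (fun z => 2 * inner ℝ b (N z)) ν := (hN.const_inner b).const_mul 2
  have h2 : Integrable (fun z => ‖b‖ ^ 2 + 2 * inner ℝ b (N z)) ν := (integrable_const _).add h1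
  rw [integral_add h2 hN2, integral_add (integrable_const _) h1,
    integral_const_mul, integral_inner hN, h0]
  simp

theorem integral_norm_sub_mean_sq_le {D : Ξ → H} (hD : Integrable D ν)
    (hD2 : Integrable (fun z => ‖D z‖ ^ 2) ν) {m : H} (hm : ∫ z, D z ∂ν = m) :
    Integrable (fun z => ‖D z - m‖ ^ 2) ν ∧ ∫ z, ‖D z - m‖ ^ 2 ∂ν ≤ ∫ z, ‖D z‖ ^ 2 ∂ν := by
  have h1 : Integrable (fun z => ‖D z - m‖ ^ 2) ν := by
    simpa [sub_eq_neg_add] using integrable_norm_add_sq hD hD2 (-m)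
  refine ⟨h1, ?_⟩
  have h2 : Integrable (fun z => D z - m) ν := hD.sub (integrable_const _)
  have h3 : ∫ z, (D z - m) ∂ν = 0 := by
    rw [integral_sub hD (integrable_const _), hm]; simp
  have h4 := integral_norm_add_sq h2 h1 h3 m
  simp only [add_sub_cancel] at h4
  rw [h4]
  exact le_add_of_nonneg_left (sq_nonneg _)

/-- The second moment of the error of the momentum estimate with variance reduction. -/
theorem lintegral_momentum_error_le (ha : Integrable a ν) (hA : ∫ z, a z ∂ν = A)
    (hb : Integrable b ν) (hB : ∫ z, b z ∂ν = B)
    (hv : Integrable (fun z => ‖a z - A‖ ^ 2) ν) (hv' : ∫ z, ‖a z - A‖ ^ 2 ∂ν ≤ σ2)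
    (hl : Integrable (fun z => ‖a z - b z‖ ^ 2) ν) (hl' : ∫ z, ‖a z - b z‖ ^ 2 ∂ν ≤ l2)
    (h0 : 0 ≤ β) (h1 : β ≤ 1) (q : H) :
    ∫⁻ z, ENNReal.ofReal (‖(1 - β) • q + β • a z + (1 - β) • (a z - b z) - A‖ ^ 2) ∂ν
      ≤ ENNReal.ofReal ((1 - β) ^ 2 * ‖q - B‖ ^ 2 + 2 * β ^ 2 * σ2 + 2 * l2) := by
  obtain ⟨hw, hw'⟩ := integral_norm_sub_mean_sq_le (ha.sub hb) hl (m := A - B) (by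
    simp only [Pi.sub_apply]
    rw [integral_sub ha hb, hA, hB])
  simp only [Pi.sub_apply] at hw hw'
  set N : Ξ → H := fun z => β • (a z - A) + (1 - β) • ((a z - b z) - (A - B)) with hNdef
  have iN : Integrable N ν := ((ha.sub (integrable_const _)).smul β).add
    (((ha.sub hb).sub (integrable_const _)).smul (1 - β))
  have mN : ∫ z, N z ∂ν = 0 := by
    have e : N = fun z => (a z - (1 - β) • b z) - (A - (1 - β) • B) := by
      funext z; simp only [hNdef]; module
    have i1 : Integrable (fun z => a z - (1 - β) • b z) ν := ha.sub (hb.smul _)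
    have i2 : Integrable (fun z => (1 - β) • b z) ν := hb.smul _
    rw [e, integral_sub i1 (integrable_const _), integral_sub ha i2, integral_smul, hA, hB]
    simp
  have hle : ∀ z, ‖N z‖ ^ 2 ≤ 2 * β ^ 2 * ‖a z - A‖ ^ 2 + 2 * ‖a z - b z - (A - B)‖ ^ 2 := by
    intro z
    refine (norm_add_sq_le_two _ _).trans ?_
    rw [norm_smul, norm_smul, mul_pow, mul_pow, Real.norm_eq_abs, sq_abs, Real.norm_eq_abs, sq_abs]
    have : (1 - β) ^ 2 ≤ 1 := by nlinarith
    nlinarith [mul_le_mul_of_nonneg_right this (sq_nonneg ‖a z - b z - (A - B)‖)]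
  have iR : Integrable (fun z => 2 * β ^ 2 * ‖a z - A‖ ^ 2 + 2 * ‖a z - b z - (A - B)‖ ^ 2) ν :=
    (hv.const_mul _).add (hw.const_mul _)
  have iN2 : Integrable (fun z => ‖N z‖ ^ 2) ν :=
    iR.mono' (iN.aestronglyMeasurable.norm.pow 2) (.of_forall fun z => by
      rw [Real.norm_eq_abs, abs_of_nonneg (sq_nonneg _)]; exact hle z)
  -- The new error splits into the contracted old error and centred noise.
  have e : ∀ z, (1 - β) • q + β • a z + (1 - β) • (a z - b z) - A = (1 - β) • (q - B) + N z := by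
    intro z; simp only [hNdef]; module
  simp only [e]
  rw [← ofReal_integral_eq_lintegral_ofReal (integrable_norm_add_sq iN iN2 _)
    (.of_forall fun z => sq_nonneg _), integral_norm_add_sq iN iN2 mN]
  refine ENNReal.ofReal_le_ofReal ?_
  have h5 := integral_mono iN2 iR hle
  rw [integral_add (hv.const_mul _) (hw.const_mul _), integral_const_mul, integral_const_mul] at h5
  rw [norm_smul, mul_pow, Real.norm_eq_abs, sq_abs]
  have h6 := mul_le_mul_of_nonneg_left hv' (by positivity : 0 ≤ 2 * β ^ 2)
  linarith

end Moments

/-- Monotonicity of expectation under affine bounds, without integrability assumptions. -/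
theorem lintegral_ofReal_affine_le {Ω : Type*} [MeasurableSpace Ω] {Pr : Measure Ω}
    [IsProbabilityMeasure Pr] {X : Ω → ℝ} (hX : Measurable X) (hX0 : ∀ ω, 0 ≤ X ω) {p q M : ℝ}
    (hp : 0 ≤ p) (hq : 0 ≤ q) (hM : 0 ≤ M)
    (h : ∫⁻ ω, ENNReal.ofReal (X ω) ∂Pr ≤ ENNReal.ofReal M) :
    ∫⁻ ω, ENNReal.ofReal (p + q * X ω) ∂Pr ≤ ENNReal.ofReal (p + q * M) := by
  have e : ∀ ω, ENNReal.ofReal (p + q * X ω)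
      = ENNReal.ofReal p + ENNReal.ofReal q * ENNReal.ofReal (X ω) := fun ω => by
    rw [ENNReal.ofReal_add hp (mul_nonneg hq (hX0 ω)), ENNReal.ofReal_mul hq]
  simp only [e]
  rw [lintegral_add_left measurable_const, lintegral_const_mul _ hX.ennreal_ofReal,
    ENNReal.ofReal_add hp (mul_nonneg hq hM), ENNReal.ofReal_mul hq]
  simp only [lintegral_const, measure_univ, mul_one]
  gcongr

/-! ### Conditioning by independence. -/

section Independence

variable {Ω : Type*} {mΩ : MeasurableSpace Ω} {Pr : Measure Ω}

theorem lintegral_comp_of_indepFun [IsProbabilityMeasure Pr] {α β : Type*} [MeasurableSpace α]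
    [MeasurableSpace β] {X : Ω → α} {Z : Ω → β} (hX : Measurable X) (hZ : Measurable Z)
    (h : IndepFun X Z Pr) {f : α × β → ℝ≥0∞} (hf : Measurable f) :
    ∫⁻ ω, f (X ω, Z ω) ∂Pr = ∫⁻ ω, ∫⁻ z, f (X ω, z) ∂(Pr.map Z) ∂Pr := by
  have : IsProbabilityMeasure (Pr.map Z) := Measure.isProbabilityMeasure_map hZ.aemeasurable
  rw [← lintegral_map (f := f) hf (hX.prodMk hZ),
    (indepFun_iff_map_prod_eq_prod_map_map hX.aemeasurable hZ.aemeasurable).1 h,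
    lintegral_prod _ hf.aemeasurable, lintegral_map hf.lintegral_prod_right' hX]

theorem indepFun_of_iIndep {ι : Type*} {m : ι → MeasurableSpace Ω} (hm : ∀ i, m i ≤ mΩ)
    (h : iIndep m Pr) {S T : Set ι} (hST : Disjoint S T) {α β : Type*} [MeasurableSpace α]
    [MeasurableSpace β] {X : Ω → α} {Z : Ω → β} (hX : Measurable[⨆ i ∈ S, m i] X)
    (hZ : Measurable[⨆ i ∈ T, m i] Z) : IndepFun X Z Pr :=
  (IndepFun_iff_Indep X Z Pr).2 <| indep_of_indep_of_le_left
    (indep_of_indep_of_le_right (indep_iSup_of_disjoint hm h hST) hZ.comap_le) hX.comap_le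

end Independence

namespace Constants

variable (c : Constants)

/-- Amplification of the movement of the iterate by the layers. -/
def moveCoef : ℕ → ℝ
  | 0 => 1
  | i + 1 => 3 + 3 * (c.msLf : ℝ) ^ 2 * moveCoef i

/-- Coefficient of the increase of the tracking error in one step. -/
def trackCoef : ℝ :=
  2 * c.K + 2 * ((c.msLf : ℝ) ^ 2 + (c.msLJ : ℝ) ^ 2) * ∑ i ∈ Finset.range c.K, c.moveCoef i

/-- Sum of the variances of the two oracles. -/
def noise : ℝ := (c.σf : ℝ) ^ 2 + (c.σJ : ℝ) ^ 2

theorem moveCoef_nonneg : ∀ i, 0 ≤ c.moveCoef i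
  | 0 => zero_le_one
  | i + 1 => by
    have := moveCoef_nonneg i
    rw [moveCoef]; positivity

theorem trackCoef_nonneg : 0 ≤ c.trackCoef := by
  have := Finset.sum_nonneg fun i (_ : i ∈ Finset.range c.K) => c.moveCoef_nonneg i
  unfold trackCoef; positivity

theorem noise_nonneg : 0 ≤ c.noise := by unfold noise; positivity

end Constants

namespace Problem

/-- The information in the samples of the layers below `k`. -/
@[reducible] def below {Ω Ξ : Type*} [MeasurableSpace Ξ] (Z : ℕ → Ω → Ξ) (k : ℕ) :
    MeasurableSpace Ω :=
  ⨆ j ∈ Set.Iio k, MeasurableSpace.comap (Z j) inferInstance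

theorem measurable_below {Ω Ξ : Type*} [MeasurableSpace Ξ] {Z : ℕ → Ω → Ξ} {k j : ℕ}
    (hj : j < k) : Measurable[below Z k] (Z j) :=
  measurable_iff_comap_le.2 <|
    le_iSup₂_of_le (f := fun j (_ : j ∈ Set.Iio k) => MeasurableSpace.comap (Z j) inferInstance)
      j hj le_rfl

theorem below_le {Ω Ξ : Type*} [MeasurableSpace Ξ] [mΩ : MeasurableSpace Ω] {Z : ℕ → Ω → Ξ}
    (hZ : ∀ i, Measurable (Z i)) (k : ℕ) : below Z k ≤ mΩ :=
  iSup₂_le fun j _ => (hZ j).comap_le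

theorem Assumptions.lintegral_trackErr_le {c : Constants} {Ξ : Type*} [MeasurableSpace Ξ]
    {P : Problem c.K Ξ} (H : P.Assumptions c) {Ω : Type*} [MeasurableSpace Ω] {Pr : Measure Ω}
    {X : Ω → P.State} (hX : Measurable X) {e : ℕ → ℝ} (he : ∀ k < c.K, 0 ≤ e k)
    (h : ∀ k < c.K, ∫⁻ ω, ENNReal.ofReal (‖(X ω).u (k + 1) - P.f k ((X ω).u k)‖ ^ 2) ∂Pr
      + ∫⁻ ω, ENNReal.ofReal (frobSq ((X ω).v k - P.df k ((X ω).u k))) ∂Pr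
      ≤ ENNReal.ofReal (e k)) :
    ∫⁻ ω, ENNReal.ofReal (P.trackErr (X ω)) ∂Pr
      ≤ ENNReal.ofReal (∑ k ∈ Finset.range c.K, e k) := by
  have mu : ∀ k < c.K, Measurable fun ω => ‖(X ω).u (k + 1) - P.f k ((X ω).u k)‖ ^ 2 :=
    fun k hk => ((((measurable_u hk).comp hX).sub
      ((H.measurable_f hk).comp ((measurable_u hk.le).comp hX))).norm.pow_const 2)
  have mv : ∀ k < c.K, Measurable fun ω => frobSq ((X ω).v k - P.df k ((X ω).u k)) :=
    fun k hk => continuous_frobSq.measurable.comp (((measurable_v hk).comp hX).sub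
      ((H.measurable_df hk).comp ((measurable_u hk.le).comp hX)))
  have nn : ∀ k ω, 0 ≤ ‖(X ω).u (k + 1) - P.f k ((X ω).u k)‖ ^ 2
      + frobSq ((X ω).v k - P.df k ((X ω).u k)) :=
    fun k ω => add_nonneg (sq_nonneg _) (frobSq_nonneg _)
  have hsum : ∀ ω, ENNReal.ofReal (P.trackErr (X ω)) = ∑ k ∈ Finset.range c.K,
      (ENNReal.ofReal (‖(X ω).u (k + 1) - P.f k ((X ω).u k)‖ ^ 2)
        + ENNReal.ofReal (frobSq ((X ω).v k - P.df k ((X ω).u k)))) := by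
    intro ω
    rw [trackErr, ENNReal.ofReal_sum_of_nonneg fun k _ => nn k ω]
    exact Finset.sum_congr rfl fun k _ => ENNReal.ofReal_add (sq_nonneg _) (frobSq_nonneg _)
  simp only [hsum]
  rw [lintegral_finsetSum', ENNReal.ofReal_sum_of_nonneg fun k hk => he k (Finset.mem_range.1 hk)]
  · refine Finset.sum_le_sum fun k hk => ?_
    have hk := Finset.mem_range.1 hk
    rw [lintegral_add_left (mu k hk).ennreal_ofReal]
    exact h k hk
  · intro k hk
    have hk := Finset.mem_range.1 hk
    exact ((mu k hk).ennreal_ofReal.add (mv k hk).ennreal_ofReal).aemeasurable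

/-! ### The tracking error in one time step. -/

section OneStep

variable {c : Constants} {Ξ : Type*} [MeasurableSpace Ξ] {P : Problem c.K Ξ}
  {Ω : Type*} [mΩ : MeasurableSpace Ω] {Pr : Measure Ω} [IsProbabilityMeasure Pr]
  {Z : ℕ → Ω → Ξ}

variable (P Pr Z) in
/-- Fresh independent samples, one for each layer. -/
structure Fresh : Prop where
  meas : ∀ i, Measurable (Z i)
  law : ∀ i < c.K, Pr.map (Z i) = P.law i
  indep : iIndepFun Z Pr

/-- Conditioning on the samples of the lower layers. -/
theorem Fresh.lintegral_le (hF : P.Fresh Pr Z) {i : ℕ} (hi : i < c.K) {α : Type*}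
    [MeasurableSpace α] {Y : Ω → α} (hY : Measurable[below Z i] Y) {f : α × Ξ → ℝ≥0∞}
    (hf : Measurable f) {g : α → ℝ≥0∞} (hg : ∀ y, ∫⁻ z, f (y, z) ∂P.law i ≤ g y) :
    ∫⁻ ω, f (Y ω, Z i ω) ∂Pr ≤ ∫⁻ ω, g (Y ω) ∂Pr := by
  have hY' : Measurable Y := hY.mono (below_le hF.meas i) le_rfl
  have hind : IndepFun Y (Z i) Pr :=
    indepFun_of_iIndep (fun j => (hF.meas j).comap_le) hF.indep.iIndep
      (S := Set.Iio i) (T := {i}) (by simp) hY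
      (measurable_iff_comap_le.2 (le_iSup₂_of_le
        (f := fun j (_ : j ∈ ({i} : Set ℕ)) => MeasurableSpace.comap (Z j) inferInstance)
        i rfl le_rfl))
  rw [lintegral_comp_of_indepFun hY' (hF.meas i) hind hf, hF.law i hi]
  exact lintegral_mono fun ω => hg _

theorem Assumptions.entries_mean (H : P.Assumptions c) {i : ℕ} (hi : i < c.K) (x : Vec (P.d i)) :
    Integrable (fun z => entries (P.dg i x z)) (P.law i) ∧
      ∫ z, entries (P.dg i x z) ∂P.law i = entries (P.df i x) := by
  obtain ⟨h1, h2⟩ := H.dg_mean i hi x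
  exact ⟨entries.integrable_comp h1, by rw [entries.integral_comp_comm h1, h2]⟩

variable (P) in
/-- The regularized stochastic gradient estimate of a state. -/
noncomputable def dir (μ : ℝ) (x : P.State) : Vec (P.d 0) := P.grad x.v + μ • x.w

/-- Level 0 moves by `η • dir`. A higher level moves by a `β`-multiple of its old error, a
`β`-multiple of noise, and an oracle difference controlled by the movement of the level below; the
factor 3 comes from squaring three terms. -/
theorem Assumptions.lintegral_move_le (H : P.Assumptions c) (hF : P.Fresh Pr Z) (μ η β : ℝ)
    (x : P.State) : ∀ k ≤ c.K,
    ∫⁻ ω, ENNReal.ofReal (‖P.nextU μ η β x (fun i => Z i ω) k - x.u k‖ ^ 2) ∂Pr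
      ≤ ENNReal.ofReal (c.moveCoef k *
        (η ^ 2 * ‖P.dir μ x‖ ^ 2 + β ^ 2 * P.trackErr x + β ^ 2 * c.noise))
  | 0, _ => by
    have e : P.nextW μ η x - x.u 0 = -(η • P.dir μ x) := by
      rw [nextW, State.w, dir, State.w]; abel
    have h : ∀ z : ℕ → Ξ, P.nextU μ η β x z 0 = P.nextW μ η x := fun z => rfl
    simp only [h, e, lintegral_const, measure_univ, mul_one]
    refine ENNReal.ofReal_le_ofReal ?_
    rw [norm_neg, norm_smul, mul_pow, Real.norm_eq_abs, sq_abs, Constants.moveCoef]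
    have := P.trackErr_nonneg x
    have := c.noise_nonneg
    nlinarith [mul_nonneg (sq_nonneg β) (P.trackErr_nonneg x),
      mul_nonneg (sq_nonneg β) c.noise_nonneg]
  | k + 1, hk => by
    have ih := H.lintegral_move_le hF μ η β x k (Nat.le_of_succ_le hk)
    have hprob := H.prob k hk
    set B := η ^ 2 * ‖P.dir μ x‖ ^ 2 + β ^ 2 * P.trackErr x + β ^ 2 * c.noise
    -- The query point of layer `k` depends only on samples of lower layers, so it can be frozen
    -- while integrating over the sample of layer `k`.
    have hY : Measurable[below Z k] fun ω => P.nextU μ η β x (fun i => Z i ω) k :=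
      @Assumptions.measurable_nextU c Ξ _ P H μ η β Ω (below Z k) (fun _ => x)
        (fun ω i => Z i ω) measurable_const k (Nat.le_of_succ_le hk)
        fun j hj => measurable_below hj
    have hg := H.g_meas k hk
    have hgx : Measurable (P.g k (x.u k)) := hg.comp measurable_prodMk_left
    have hf : Measurable fun p : Vec (P.d k) × Ξ => ENNReal.ofReal
        (‖(1 - β) • x.u (k + 1) + β • P.g k p.1 p.2
          + (1 - β) • (P.g k p.1 p.2 - P.g k (x.u k) p.2) - x.u (k + 1)‖ ^ 2) := by
      have : Measurable fun p : Vec (P.d k) × Ξ => P.g k (x.u k) p.2 := hgx.comp measurable_snd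
      exact ENNReal.measurable_ofReal.comp ((((((hg.const_smul β).const_add _)).add
        ((hg.sub this).const_smul (1 - β))).sub_const _).norm.pow_const 2)
    have key := hF.lintegral_le hk hY hf (g := fun y => ENNReal.ofReal
        (3 * β ^ 2 * ‖x.u (k + 1) - P.f k (x.u k)‖ ^ 2 + 3 * β ^ 2 * (c.σf : ℝ) ^ 2
          + 3 * ((c.msLf : ℝ) ^ 2 * ‖y - x.u k‖ ^ 2)))
      fun y => lintegral_momentum_move_le (H.g_var k hk _).1 (H.g_var k hk _).2
        (H.g_ms k hk _ _).1 (H.g_ms k hk _ _).2 _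
    refine key.trans ?_
    have hY' := hY.mono (below_le hF.meas k) le_rfl
    have hB : 0 ≤ B := by
      have := P.trackErr_nonneg x
      have := c.noise_nonneg
      positivity
    have h := lintegral_ofReal_affine_le (Pr := Pr) ((hY'.sub_const (x.u k)).norm.pow_const 2)
      (fun _ => sq_nonneg _)
      (p := 3 * β ^ 2 * ‖x.u (k + 1) - P.f k (x.u k)‖ ^ 2 + 3 * β ^ 2 * (c.σf : ℝ) ^ 2)
      (q := 3 * (c.msLf : ℝ) ^ 2) (by positivity) (by positivity)
      (mul_nonneg (c.moveCoef_nonneg k) hB) ih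
    simp only [← mul_assoc] at h ⊢
    refine h.trans (ENNReal.ofReal_le_ofReal ?_)
    have h1 : ‖x.u (k + 1) - P.f k (x.u k)‖ ^ 2 ≤ P.trackErr x := by
      refine le_trans ?_ (Finset.single_le_sum (f := fun i => ‖x.u (i + 1) - P.f i (x.u i)‖ ^ 2
        + frobSq (x.v i - P.df i (x.u i)))
        (fun _ _ => add_nonneg (sq_nonneg _) (frobSq_nonneg _)) (Finset.mem_range.2 hk))
      exact le_add_of_nonneg_right (frobSq_nonneg _)
    have h2 : (c.σf : ℝ) ^ 2 ≤ c.noise := le_add_of_nonneg_right (sq_nonneg _)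
    have h3 : β ^ 2 * ‖x.u (k + 1) - P.f k (x.u k)‖ ^ 2 + β ^ 2 * (c.σf : ℝ) ^ 2 ≤ B := by
      have := mul_le_mul_of_nonneg_left h1 (sq_nonneg β)
      have := mul_le_mul_of_nonneg_left h2 (sq_nonneg β)
      have : 0 ≤ η ^ 2 * ‖P.dir μ x‖ ^ 2 := by positivity
      simp only [B]; linarith
    rw [Constants.moveCoef]
    linarith

theorem Assumptions.lintegral_value_error_le (H : P.Assumptions c) (hF : P.Fresh Pr Z) (μ η : ℝ)
    {β : ℝ} (h0 : 0 ≤ β) (h1 : β ≤ 1) (x : P.State) {k : ℕ} (hk : k < c.K) :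
    ∫⁻ ω, ENNReal.ofReal (‖P.nextU μ η β x (fun i => Z i ω) (k + 1)
        - P.f k (P.nextU μ η β x (fun i => Z i ω) k)‖ ^ 2) ∂Pr
      ≤ ENNReal.ofReal ((1 - β) ^ 2 * ‖x.u (k + 1) - P.f k (x.u k)‖ ^ 2
        + 2 * β ^ 2 * (c.σf : ℝ) ^ 2 + 2 * (c.msLf : ℝ) ^ 2 * (c.moveCoef k *
        (η ^ 2 * ‖P.dir μ x‖ ^ 2 + β ^ 2 * P.trackErr x + β ^ 2 * c.noise))) := by
  have ih := H.lintegral_move_le hF μ η β x k hk.le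
  have hprob := H.prob k hk
  have hY : Measurable[below Z k] fun ω => P.nextU μ η β x (fun i => Z i ω) k :=
    @Assumptions.measurable_nextU c Ξ _ P H μ η β Ω (below Z k) (fun _ => x)
      (fun ω i => Z i ω) measurable_const k hk.le fun j hj => measurable_below hj
  have hY' := hY.mono (below_le hF.meas k) le_rfl
  have hg := H.g_meas k hk
  have hgx : Measurable (P.g k (x.u k)) := hg.comp measurable_prodMk_left
  have hf : Measurable fun p : Vec (P.d k) × Ξ => ENNReal.ofReal
      (‖(1 - β) • x.u (k + 1) + β • P.g k p.1 p.2
        + (1 - β) • (P.g k p.1 p.2 - P.g k (x.u k) p.2) - P.f k p.1‖ ^ 2) := by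
    have h2 : Measurable fun p : Vec (P.d k) × Ξ => P.g k (x.u k) p.2 := hgx.comp measurable_snd
    have h3 : Measurable fun p : Vec (P.d k) × Ξ => P.f k p.1 :=
      (H.measurable_f hk).comp measurable_fst
    exact ENNReal.measurable_ofReal.comp ((((((hg.const_smul β).const_add _)).add
      ((hg.sub h2).const_smul (1 - β))).sub h3).norm.pow_const 2)
  have key := hF.lintegral_le hk hY hf (g := fun y => ENNReal.ofReal
      ((1 - β) ^ 2 * ‖x.u (k + 1) - P.f k (x.u k)‖ ^ 2 + 2 * β ^ 2 * (c.σf : ℝ) ^ 2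
        + 2 * ((c.msLf : ℝ) ^ 2 * ‖y - x.u k‖ ^ 2)))
    fun y => lintegral_momentum_error_le (H.g_mean k hk _).1 (H.g_mean k hk _).2
      (H.g_mean k hk _).1 (H.g_mean k hk _).2 (H.g_var k hk _).1 (H.g_var k hk _).2
      (H.g_ms k hk _ _).1 (H.g_ms k hk _ _).2 h0 h1 _
  refine key.trans ?_
  have hM := c.moveCoef_nonneg k
  have hV := P.trackErr_nonneg x
  have hn := c.noise_nonneg
  have h := lintegral_ofReal_affine_le (Pr := Pr) ((hY'.sub_const (x.u k)).norm.pow_const 2)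
    (fun _ => sq_nonneg _)
    (p := (1 - β) ^ 2 * ‖x.u (k + 1) - P.f k (x.u k)‖ ^ 2 + 2 * β ^ 2 * (c.σf : ℝ) ^ 2)
    (q := 2 * (c.msLf : ℝ) ^ 2) (by positivity) (by positivity) (by positivity) ih
  simpa only [← mul_assoc] using h

theorem Assumptions.lintegral_jacobian_error_le (H : P.Assumptions c) (hF : P.Fresh Pr Z)
    (μ η : ℝ) {β : ℝ} (h0 : 0 ≤ β) (h1 : β ≤ 1) (x : P.State) {k : ℕ} (hk : k < c.K) :
    ∫⁻ ω, ENNReal.ofReal (frobSq (P.nextV c.Lf μ η β x (fun i => Z i ω) k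
        - P.df k (P.nextU μ η β x (fun i => Z i ω) k))) ∂Pr
      ≤ ENNReal.ofReal ((1 - β) ^ 2 * frobSq (x.v k - P.df k (x.u k))
        + 2 * β ^ 2 * (c.σJ : ℝ) ^ 2 + 2 * (c.msLJ : ℝ) ^ 2 * (c.moveCoef k *
        (η ^ 2 * ‖P.dir μ x‖ ^ 2 + β ^ 2 * P.trackErr x + β ^ 2 * c.noise))) := by
  have ih := H.lintegral_move_le hF μ η β x k hk.le
  have hprob := H.prob k hk
  have hY : Measurable[below Z k] fun ω => P.nextU μ η β x (fun i => Z i ω) k :=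
    @Assumptions.measurable_nextU c Ξ _ P H μ η β Ω (below Z k) (fun _ => x)
      (fun ω i => Z i ω) measurable_const k hk.le fun j hj => measurable_below hj
  have hY' := hY.mono (below_le hF.meas k) le_rfl
  have hg := H.dg_meas k hk
  have hgx : Measurable (P.dg k (x.u k)) := hg.comp measurable_prodMk_left
  have hf : Measurable fun p : Vec (P.d k) × Ξ => ENNReal.ofReal
      (frobSq ((1 - β) • x.v k + β • P.dg k p.1 p.2
        + (1 - β) • (P.dg k p.1 p.2 - P.dg k (x.u k) p.2) - P.df k p.1)) := by
    have h2 : Measurable fun p : Vec (P.d k) × Ξ => P.dg k (x.u k) p.2 := hgx.comp measurable_snd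
    have h3 : Measurable fun p : Vec (P.d k) × Ξ => P.df k p.1 :=
      (H.measurable_df hk).comp measurable_fst
    exact ENNReal.measurable_ofReal.comp (continuous_frobSq.measurable.comp
      ((((hg.const_smul β).const_add _).add ((hg.sub h2).const_smul (1 - β))).sub h3))
  have key := hF.lintegral_le hk hY hf (g := fun y => ENNReal.ofReal
      ((1 - β) ^ 2 * frobSq (x.v k - P.df k (x.u k)) + 2 * β ^ 2 * (c.σJ : ℝ) ^ 2
        + 2 * ((c.msLJ : ℝ) ^ 2 * ‖y - x.u k‖ ^ 2)))
    fun y => by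
      have hv := H.dg_var k hk y
      have hl := H.dg_ms k hk y (x.u k)
      have := lintegral_momentum_error_le (ν := P.law k) (σ2 := (c.σJ : ℝ) ^ 2)
        (l2 := (c.msLJ : ℝ) ^ 2 * ‖y - x.u k‖ ^ 2)
        (H.entries_mean hk y).1 (H.entries_mean hk y).2
        (H.entries_mean hk (x.u k)).1 (H.entries_mean hk (x.u k)).2
        (by simpa only [← map_sub, norm_sq_entries] using hv.1)
        (by simpa only [← map_sub, norm_sq_entries] using hv.2)
        (by simpa only [← map_sub, norm_sq_entries] using hl.1)
        (by simpa only [← map_sub, norm_sq_entries] using hl.2) h0 h1 (entries (x.v k))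
      simpa only [← map_sub, ← map_smul, ← map_add, norm_sq_entries] using this
  -- The exact Jacobian is in the ball, so the projection may be dropped.
  refine le_trans (lintegral_mono fun ω => ENNReal.ofReal_le_ofReal
    (frobSq_proj_sub_le c.Lf _ (H.norm_df_le hk _))) (key.trans ?_)
  have hM := c.moveCoef_nonneg k
  have hV := P.trackErr_nonneg x
  have hn := c.noise_nonneg
  have h := lintegral_ofReal_affine_le (Pr := Pr) ((hY'.sub_const (x.u k)).norm.pow_const 2)
    (fun _ => sq_nonneg _)
    (p := (1 - β) ^ 2 * frobSq (x.v k - P.df k (x.u k)) + 2 * β ^ 2 * (c.σJ : ℝ) ^ 2)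
    (q := 2 * (c.msLJ : ℝ) ^ 2)
    (add_nonneg (mul_nonneg (sq_nonneg _) (frobSq_nonneg _)) (by positivity))
    (by positivity) (by positivity) ih
  simpa only [← mul_assoc] using h

theorem Assumptions.lintegral_trackErr_step_le (H : P.Assumptions c) (hF : P.Fresh Pr Z)
    (μ η : ℝ) {β : ℝ} (h0 : 0 ≤ β) (h1 : β ≤ 1) (x : P.State) :
    ∫⁻ ω, ENNReal.ofReal (P.trackErr (P.step c.Lf μ η β x (fun i => Z i ω))) ∂Pr
      ≤ ENNReal.ofReal ((1 - β) ^ 2 * P.trackErr x + c.trackCoef *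
        (η ^ 2 * ‖P.dir μ x‖ ^ 2 + β ^ 2 * P.trackErr x + β ^ 2 * c.noise)) := by
  have hV := P.trackErr_nonneg x
  have hn := c.noise_nonneg
  set B := η ^ 2 * ‖P.dir μ x‖ ^ 2 + β ^ 2 * P.trackErr x + β ^ 2 * c.noise with hBdef
  have hB : 0 ≤ B := by positivity
  have hX : Measurable fun ω => P.step c.Lf μ η β x (fun i => Z i ω) :=
    H.measurable_step c.Lf μ η β measurable_const hF.meas
  have hM := c.moveCoef_nonneg
  have hfr := fun k => frobSq_nonneg (x.v k - P.df k (x.u k))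
  refine (H.lintegral_trackErr_le (e := fun k => (1 - β) ^ 2 * (‖x.u (k + 1) - P.f k (x.u k)‖ ^ 2
      + frobSq (x.v k - P.df k (x.u k))) + 2 * β ^ 2 * c.noise
      + 2 * ((c.msLf : ℝ) ^ 2 + (c.msLJ : ℝ) ^ 2) * c.moveCoef k * B) hX (fun k _ => ?_)
      fun k hk => ?_).trans ?_
  · have := hM k
    have := hfr k
    positivity
  · refine (add_le_add (H.lintegral_value_error_le hF μ η h0 h1 x hk)
      (H.lintegral_jacobian_error_le hF μ η h0 h1 x hk)).trans ?_
    have := hM k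
    have := hfr k
    rw [← hBdef, ← ENNReal.ofReal_add (by positivity) (by positivity)]
    refine ENNReal.ofReal_le_ofReal (le_of_eq ?_)
    rw [Constants.noise]
    ring
  refine ENNReal.ofReal_le_ofReal ?_
  rw [Finset.sum_add_distrib, Finset.sum_add_distrib, ← Finset.mul_sum, Finset.sum_const,
    Finset.card_range, nsmul_eq_mul, ← Finset.sum_mul, ← Finset.mul_sum, Constants.trackCoef,
    ← trackErr]
  -- The direct oracle noise of all layers is absorbed into `B`; this accounts for the summand `2 *
  -- K` of `trackCoef`.
  have h5 : β ^ 2 * c.noise ≤ B := by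
    have : 0 ≤ η ^ 2 * ‖P.dir μ x‖ ^ 2 + β ^ 2 * P.trackErr x := by positivity
    linarith
  have h6 := mul_le_mul_of_nonneg_left h5 (by positivity : (0 : ℝ) ≤ 2 * c.K)
  linarith

end OneStep

end Problem

end SMVR

namespace SMVR

namespace Constants

variable (c : Constants)

/-- Bound on the second moment of the error of the very first gradient estimate. -/
def initCoef : ℝ := 2 * (2 * (c.σJ : ℝ) ^ 2 + 2 * (c.Lf : ℝ) ^ 2) ^ c.K + 2 * ((c.Lf : ℝ) ^ c.K) ^ 2

theorem initCoef_nonneg : 0 ≤ c.initCoef := by unfold initCoef; positivity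

end Constants

namespace Problem

/-! ### The energy decrease. -/

section Energy

variable {c : Constants} {Ξ : Type*} [MeasurableSpace Ξ] (P : Problem c.K Ξ)

/-- The optimality gap of the regularized objective plus a multiple of the tracking error. -/
noncomputable def energy (μ lam : ℝ) (x : P.State) : ℝ :=
  P.reg μ x.w - (⨅ w, P.reg μ w) + lam * P.trackErr x

/-- The squared gradient norm plus a multiple of the tracking error. -/
noncomputable def resid (μ L : ℝ) (x : P.State) : ℝ :=
  ‖P.gradReg μ x.w‖ ^ 2 + 4 * L * P.trackErr x

open Classical in
/-- The squared error of the gradient estimate at states with a Jacobian estimate outside of the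
ball of radius `Lf`, and zero at the other states. -/
noncomputable def clipErr (x : P.State) : ℝ :=
  if ∀ i < c.K, ‖x.v i‖ ≤ c.Lf then 0 else ‖P.grad x.v - P.gradF x.w‖ ^ 2

theorem clipErr_nonneg (x : P.State) : 0 ≤ P.clipErr x := by
  unfold clipErr; split_ifs <;> positivity

theorem clipErr_le (x : P.State) : P.clipErr x ≤ ‖P.grad x.v - P.gradF x.w‖ ^ 2 := by
  unfold clipErr; split_ifs <;> first | positivity | exact le_rfl

theorem clipErr_step (μ η β : ℝ) (x : P.State) (z : ℕ → Ξ) :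
    P.clipErr (P.step c.Lf μ η β x z) = 0 :=
  if_pos fun _ _ => norm_proj_le _ _

theorem resid_nonneg {μ L : ℝ} (hL : 0 ≤ L) (x : P.State) : 0 ≤ P.resid μ L x := by
  have := P.trackErr_nonneg x
  unfold resid; positivity

variable {P}

theorem Assumptions.measurable_clipErr (H : P.Assumptions c) : Measurable P.clipErr := by
  classical
  unfold clipErr
  refine Measurable.ite ?_ measurable_const ?_
  · simp only [Set.ofPred_forall]
    exact .iInter fun i => .iInter fun hi =>
      measurableSet_le (measurable_v hi).norm measurable_const
  · exact ((measurable_grad.sub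
      (H.continuous_gradF.measurable.comp measurable_w)).norm.pow_const 2)

theorem Assumptions.measurable_energy (H : P.Assumptions c) (μ lam : ℝ) :
    Measurable (P.energy μ lam) :=
  (((H.measurable_reg μ).comp measurable_w).sub_const _).add (H.measurable_trackErr.const_mul lam)

theorem Assumptions.measurable_resid (H : P.Assumptions c) (μ L : ℝ) :
    Measurable (P.resid μ L) :=
  (((H.measurable_gradReg μ).comp measurable_w).norm.pow_const 2).add
    (H.measurable_trackErr.const_mul (4 * L))

theorem energy_nonneg {μ lam : ℝ} (hb : BddBelow (Set.range (P.reg μ))) (hlam : 0 ≤ lam)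
    (x : P.State) : 0 ≤ P.energy μ lam x :=
  add_nonneg (sub_nonneg.2 (ciInf_le hb _)) (mul_nonneg hlam (P.trackErr_nonneg x))

/-- The regularizer is exact and cancels; outside of the ball `clipErr` itself is the missing bias
bound. -/
theorem Assumptions.norm_sq_dir_sub_le (H : P.Assumptions c) (μ : ℝ) (x : P.State) :
    ‖P.dir μ x - P.gradReg μ x.w‖ ^ 2 ≤ c.biasCoef * P.trackErr x + P.clipErr x := by
  have e : P.dir μ x - P.gradReg μ x.w = P.grad x.v - P.gradF x.w := by
    rw [dir, gradReg]; abel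
  rw [e]
  by_cases h : ∀ i < c.K, ‖x.v i‖ ≤ c.Lf
  · have := H.norm_sq_grad_sub_gradF_le x h
    have := P.clipErr_nonneg x
    linarith
  · rw [clipErr, if_neg h]
    have := mul_nonneg c.biasCoef_nonneg (P.trackErr_nonneg x)
    linarith

variable {Ω : Type*} [MeasurableSpace Ω] {Pr : Measure Ω} [IsProbabilityMeasure Pr]
  {Z : ℕ → Ω → Ξ}

/-- One step decreases the expected energy by a multiple of the residual, up to noise. -/
theorem Assumptions.lintegral_energy_step_le (H : P.Assumptions c) (hF : P.Fresh Pr Z)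
    {μ η L : ℝ} (hb : BddBelow (Set.range (P.reg μ))) (hμ : 0 ≤ μ) (hη : 0 < η) (hL : 0 < L)
    (hs : η * (c.smoothCoef + μ) ≤ 1 / 4) (hC : c.trackCoef ≤ L) (hg : c.biasCoef ≤ 4 * L)
    (hβ : 16 * L ^ 2 * η ^ 2 * (1 + c.trackCoef) ≤ 1) (x : P.State) :
    ∫⁻ ω, ENNReal.ofReal (P.energy μ (1 / (4 * L * η))
        (P.step c.Lf μ η (16 * L ^ 2 * η ^ 2) x (fun i => Z i ω))) ∂Pr
        + ENNReal.ofReal (η / 2 * P.resid μ L x)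
      ≤ ENNReal.ofReal (P.energy μ (1 / (4 * L * η)) x) + ENNReal.ofReal (η / 2 * P.clipErr x)
        + ENNReal.ofReal (1 / (4 * L * η) * c.trackCoef * (16 * L ^ 2 * η ^ 2) ^ 2 * c.noise) := by
  have hV := P.trackErr_nonneg x
  have hn := c.noise_nonneg
  have hC0 := c.trackCoef_nonneg
  have hcl := P.clipErr_nonneg x
  have hlam : 0 < 1 / (4 * L * η) := by positivity
  set β := 16 * L ^ 2 * η ^ 2 with hβdef
  have hβ0 : 0 ≤ β := by positivity
  have hβ1 : β ≤ 1 := le_trans (le_mul_of_one_le_right hβ0 (by linarith)) hβ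
  -- The weight `1/(4Lη)` is balanced: the contraction of `V` then yields `4Lη V`, of which `2Lη V`
  -- pays the bias and `2Lη V` is the residual's share.
  have hlβ : 1 / (4 * L * η) * β = 4 * L * η := by rw [hβdef]; field_simp; ring
  -- The displacement term is no larger than the `η/4 ‖dir‖²` spared in the descent inequality.
  have hlη : 1 / (4 * L * η) * η ^ 2 * c.trackCoef ≤ η / 4 := by
    have : 1 / (4 * L * η) * η ^ 2 * c.trackCoef = η / 4 * (c.trackCoef / L) := by
      field_simp
    rw [this]
    exact mul_le_of_le_one_right (by positivity) ((div_le_one hL).2 hC)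
  set lam := 1 / (4 * L * η)
  have hX : Measurable fun ω => P.step c.Lf μ η β x (fun i => Z i ω) :=
    H.measurable_step c.Lf μ η β measurable_const hF.meas
  have h1 := lintegral_ofReal_affine_le (Pr := Pr) (H.measurable_trackErr.comp hX)
    (fun _ => P.trackErr_nonneg _) (p := P.reg μ (P.nextW μ η x) - (⨅ w, P.reg μ w)) (q := lam)
    (sub_nonneg.2 (ciInf_le hb _)) hlam.le (by positivity)
    (H.lintegral_trackErr_step_le hF μ η hβ0 hβ1 x)
  have h2 := H.reg_step_le hμ hη.le hs x.w (P.dir μ x)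
  have h3 := mul_le_mul_of_nonneg_left (H.norm_sq_dir_sub_le μ x) (by positivity : 0 ≤ η / 2)
  have h4 := mul_le_mul_of_nonneg_right hlη (sq_nonneg ‖P.dir μ x‖)
  have h5 := mul_le_mul_of_nonneg_left (mul_le_mul_of_nonneg_right hg hV)
    (by positivity : 0 ≤ η / 2)
  -- Of the gain `2 lam β V` in `(1 - β)²`, the terms of order `β²` consume at most one half.
  have h6 : lam * β * (β * (1 + c.trackCoef)) * P.trackErr x ≤ 4 * L * η * P.trackErr x := by
    rw [hlβ]
    exact mul_le_mul_of_nonneg_right (mul_le_of_le_one_right (by positivity) hβ) hV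
  have h7 : lam * β * P.trackErr x = 4 * L * η * P.trackErr x := by rw [hlβ]
  have h8 : P.reg μ (P.nextW μ η x) = P.reg μ (x.w - η • P.dir μ x) := rfl
  have hR := P.resid_nonneg (μ := μ) hL.le x
  have hE := energy_nonneg hb hlam.le x
  have hE' : ∀ ω, P.energy μ lam (P.step c.Lf μ η β x (fun i => Z i ω))
      = P.reg μ (P.nextW μ η x) - (⨅ w, P.reg μ w)
        + lam * P.trackErr (P.step c.Lf μ η β x (fun i => Z i ω)) := fun _ => rfl
  simp only [hE']
  refine (add_le_add_left h1 _).trans ?_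
  have hG : 0 ≤ P.reg μ (P.nextW μ η x) - ⨅ w, P.reg μ w := sub_nonneg.2 (ciInf_le hb _)
  rw [← ENNReal.ofReal_add (by positivity) (by positivity),
    ← ENNReal.ofReal_add hE (by positivity), ← ENNReal.ofReal_add (by positivity) (by positivity)]
  refine ENNReal.ofReal_le_ofReal ?_
  rw [h8, resid, energy]
  linarith

end Energy

/-! ### The initial state. -/

section Initial

variable {c : Constants} {Ξ : Type*} [MeasurableSpace Ξ] {P : Problem c.K Ξ}
  {Ω : Type*} [mΩ : MeasurableSpace Ω] {Pr : Measure Ω} [IsProbabilityMeasure Pr]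
  {Z : ℕ → Ω → Ξ}

theorem Assumptions.lintegral_trackErr_initState_le (H : P.Assumptions c) (hF : P.Fresh Pr Z)
    (w : Vec (P.d 0)) :
    ∫⁻ ω, ENNReal.ofReal (P.trackErr (P.initState w (fun i => Z i ω))) ∂Pr
      ≤ ENNReal.ofReal (c.K * c.noise) := by
  have hn := c.noise_nonneg
  refine (H.lintegral_trackErr_le (H.measurable_initState w hF.meas) (e := fun _ => c.noise)
    (fun _ _ => hn) fun k hk => ?_).trans (by simp)
  have hY : Measurable[below Z k] fun ω => P.initU w (fun i => Z i ω) k :=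
    @Assumptions.measurable_initU c Ξ _ P H w Ω (below Z k) (fun ω i => Z i ω) k hk.le
      fun j hj => measurable_below hj
  rw [Constants.noise, ENNReal.ofReal_add (sq_nonneg _) (sq_nonneg _)]
  refine add_le_add ?_ ?_
  · have hf : Measurable fun p : Vec (P.d k) × Ξ => ENNReal.ofReal
        (‖P.g k p.1 p.2 - P.f k p.1‖ ^ 2) :=
      (((H.g_meas k hk).sub ((H.measurable_f hk).comp measurable_fst)).norm.pow_const
        2).ennreal_ofReal
    refine (hF.lintegral_le hk hY hf (g := fun _ => ENNReal.ofReal ((c.σf : ℝ) ^ 2))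
      fun y => ?_).trans (by simp)
    rw [← ofReal_integral_eq_lintegral_ofReal (H.g_var k hk y).1 (.of_forall fun _ => sq_nonneg _)]
    exact ENNReal.ofReal_le_ofReal (H.g_var k hk y).2
  · have hf : Measurable fun p : Vec (P.d k) × Ξ => ENNReal.ofReal
        (frobSq (P.dg k p.1 p.2 - P.df k p.1)) :=
      (continuous_frobSq.measurable.comp
        ((H.dg_meas k hk).sub ((H.measurable_df hk).comp measurable_fst))).ennreal_ofReal
    refine (hF.lintegral_le hk hY hf (g := fun _ => ENNReal.ofReal ((c.σJ : ℝ) ^ 2))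
      fun y => ?_).trans (by simp)
    rw [← ofReal_integral_eq_lintegral_ofReal (H.dg_var k hk y).1
      (.of_forall fun _ => frobSq_nonneg _)]
    exact ENNReal.ofReal_le_ofReal (H.dg_var k hk y).2

theorem Assumptions.lintegral_norm_sq_dg_le (H : P.Assumptions c) {k : ℕ} (hk : k < c.K)
    (y : Vec (P.d k)) :
    ∫⁻ z, ENNReal.ofReal (‖P.dg k y z‖ ^ 2) ∂P.law k
      ≤ ENNReal.ofReal (2 * (c.σJ : ℝ) ^ 2 + 2 * (c.Lf : ℝ) ^ 2) := by
  have := H.prob k hk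
  obtain ⟨hi, hv⟩ := H.dg_var k hk y
  have hint : Integrable (fun z => 2 * frobSq (P.dg k y z - P.df k y) + 2 * (c.Lf : ℝ) ^ 2)
      (P.law k) := (hi.const_mul 2).add (integrable_const _)
  calc ∫⁻ z, ENNReal.ofReal (‖P.dg k y z‖ ^ 2) ∂P.law k
      ≤ ∫⁻ z, ENNReal.ofReal (2 * frobSq (P.dg k y z - P.df k y) + 2 * (c.Lf : ℝ) ^ 2)
          ∂P.law k := by
        refine lintegral_mono fun z => ENNReal.ofReal_le_ofReal ?_
        have h1 := norm_le_norm_sub_add (P.dg k y z) (P.df k y)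
        have h2 := norm_sq_le_frobSq (P.dg k y z - P.df k y)
        have h3 := H.norm_df_le hk y
        have h4 : ‖P.dg k y z‖ ≤ ‖P.dg k y z - P.df k y‖ + c.Lf := by linarith
        have h5 := pow_le_pow_left₀ (norm_nonneg _) h4 2
        nlinarith [sq_nonneg (‖P.dg k y z - P.df k y‖ - c.Lf)]
    _ = ENNReal.ofReal (∫ z, (2 * frobSq (P.dg k y z - P.df k y) + 2 * (c.Lf : ℝ) ^ 2)
          ∂P.law k) :=
        (ofReal_integral_eq_lintegral_ofReal hint (.of_forall fun z =>
          add_nonneg (mul_nonneg zero_le_two (frobSq_nonneg _)) (by positivity))).symm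
    _ ≤ _ := by
        refine ENNReal.ofReal_le_ofReal ?_
        rw [integral_add (hi.const_mul 2) (integrable_const _), integral_const_mul, integral_const]
        simp only [probReal_univ, smul_eq_mul, one_mul]
        linarith

theorem Assumptions.measurable_chain_initState (H : P.Assumptions c) (w : Vec (P.d 0)) {α : Type*}
    [MeasurableSpace α] {Y : α → ℕ → Ξ} {k : ℕ} (hk : k ≤ c.K)
    (hY : ∀ j < k, Measurable fun a => Y a j) :
    Measurable fun a => P.chain (P.initState w (Y a)).v k :=
  measurable_chain k fun i hi => (H.dg_meas i (hi.trans_le hk)).comp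
    ((H.measurable_initU w i (hi.le.trans hk) fun j hj => hY j (hj.trans hi)).prodMk (hY i hi))

/-- The noisy factors are unbounded, but given the lower layers each one has second moment at most
`2 σJ² + 2 Lf²`, so the bounds multiply. -/
theorem Assumptions.lintegral_norm_sq_chain_initState_le (H : P.Assumptions c)
    (hF : P.Fresh Pr Z) (w : Vec (P.d 0)) : ∀ k ≤ c.K,
    ∫⁻ ω, ENNReal.ofReal (‖P.chain (P.initState w (fun i => Z i ω)).v k‖ ^ 2) ∂Pr
      ≤ ENNReal.ofReal ((2 * (c.σJ : ℝ) ^ 2 + 2 * (c.Lf : ℝ) ^ 2) ^ k)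
  | 0, _ => by
    have h : ‖ContinuousLinearMap.id ℝ (Vec (P.d 0))‖ ^ 2 ≤ 1 :=
      pow_le_one₀ (norm_nonneg _) ContinuousLinearMap.norm_id_le
    have e : ∀ ω, P.chain (P.initState w (fun i => Z i ω)).v 0 = ContinuousLinearMap.id ℝ _ :=
      fun _ => rfl
    simp only [e, lintegral_const, measure_univ, mul_one, pow_zero]
    exact ENNReal.ofReal_le_ofReal h
  | k + 1, hk => by
    have ih := H.lintegral_norm_sq_chain_initState_le hF w k (Nat.le_of_succ_le hk)
    have hU : Measurable[below Z k] fun ω => P.initU w (fun i => Z i ω) k :=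
      @Assumptions.measurable_initU c Ξ _ P H w Ω (below Z k) (fun ω i => Z i ω) k
        (Nat.le_of_succ_le hk) fun j hj => measurable_below hj
    have hC : Measurable[below Z k] fun ω => P.chain (P.initState w (fun i => Z i ω)).v k :=
      @Assumptions.measurable_chain_initState c Ξ _ P H w Ω (below Z k) (fun ω i => Z i ω) k
        (Nat.le_of_succ_le hk) fun j hj => measurable_below hj
    have hY : Measurable[below Z k] fun ω => (P.initU w (fun i => Z i ω) k,
        P.chain (P.initState w (fun i => Z i ω)).v k) :=
      hU.prodMk hC
    have hf : Measurable fun p : (Vec (P.d k) × Jac (P.d 0) (P.d k)) × Ξ =>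
        ENNReal.ofReal (‖P.dg k p.1.1 p.2‖ ^ 2) * ENNReal.ofReal (‖p.1.2‖ ^ 2) :=
      (((H.dg_meas k hk).comp ((measurable_fst.comp measurable_fst).prodMk
        measurable_snd)).norm.pow_const 2).ennreal_ofReal.mul
        ((measurable_snd.comp measurable_fst).norm.pow_const 2).ennreal_ofReal
    have hle : ∀ ω, ENNReal.ofReal (‖P.chain (P.initState w (fun i => Z i ω)).v (k + 1)‖ ^ 2)
        ≤ ENNReal.ofReal (‖P.dg k (P.initU w (fun i => Z i ω) k) (Z k ω)‖ ^ 2)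
          * ENNReal.ofReal (‖P.chain (P.initState w (fun i => Z i ω)).v k‖ ^ 2) := fun ω => by
      rw [← ENNReal.ofReal_mul (sq_nonneg _), ← mul_pow]
      exact ENNReal.ofReal_le_ofReal (pow_le_pow_left₀ (norm_nonneg _)
        (ContinuousLinearMap.opNorm_comp_le _ _) 2)
    refine (lintegral_mono hle).trans ?_
    refine (hF.lintegral_le hk hY hf (g := fun y =>
      ENNReal.ofReal (2 * (c.σJ : ℝ) ^ 2 + 2 * (c.Lf : ℝ) ^ 2) * ENNReal.ofReal (‖y.2‖ ^ 2))
      fun y => ?_).trans ?_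
    · have hm : Measurable fun z => ENNReal.ofReal (‖P.dg k y.1 z‖ ^ 2) :=
        (((H.dg_meas k hk).comp measurable_prodMk_left).norm.pow_const 2).ennreal_ofReal
      dsimp only
      rw [lintegral_mul_const _ hm]
      gcongr
      exact H.lintegral_norm_sq_dg_le hk y.1
    · have hC' := hC.mono (below_le hF.meas k) le_rfl
      rw [lintegral_const_mul _ (hC'.norm.pow_const 2).ennreal_ofReal,
        pow_succ' (2 * (c.σJ : ℝ) ^ 2 + 2 * (c.Lf : ℝ) ^ 2),
        ENNReal.ofReal_mul (by positivity)]
      gcongr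

theorem Assumptions.lintegral_clipErr_initState_le (H : P.Assumptions c) (hF : P.Fresh Pr Z)
    (w : Vec (P.d 0)) :
    ∫⁻ ω, ENNReal.ofReal (P.clipErr (P.initState w (fun i => Z i ω))) ∂Pr
      ≤ ENNReal.ofReal c.initCoef := by
  have hle : ∀ ω, P.clipErr (P.initState w (fun i => Z i ω))
      ≤ 2 * ((c.Lf : ℝ) ^ c.K) ^ 2
        + 2 * ‖P.chain (P.initState w (fun i => Z i ω)).v c.K‖ ^ 2 := fun ω => by
    refine (P.clipErr_le _).trans ?_
    have h1 := norm_grad_sub_le (P := P) (P.initState w (fun i => Z i ω)).v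
      (P.exactJac (P.initState w (fun i => Z i ω)).w)
    have h2 := norm_chain_le (P := P) (r := c.Lf) c.Lf.2
      (v := P.exactJac (P.initState w (fun i => Z i ω)).w) c.K fun i hi => H.norm_df_le hi _
    have h3 := norm_sub_le (P.chain (P.initState w (fun i => Z i ω)).v c.K)
      (P.chain (P.exactJac (P.initState w (fun i => Z i ω)).w) c.K)
    have h4 : ‖P.grad (P.initState w (fun i => Z i ω)).v
        - P.gradF (P.initState w (fun i => Z i ω)).w‖
        ≤ ‖P.chain (P.initState w (fun i => Z i ω)).v c.K‖ + (c.Lf : ℝ) ^ c.K :=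
      h1.trans (h3.trans (by linarith))
    have h5 := pow_le_pow_left₀ (norm_nonneg _) h4 2
    nlinarith [sq_nonneg (‖P.chain (P.initState w (fun i => Z i ω)).v c.K‖ - (c.Lf : ℝ) ^ c.K)]
  have hX := H.measurable_initState w hF.meas
  have hC : Measurable fun ω => P.chain (P.initState w (fun i => Z i ω)).v c.K :=
    measurable_chain c.K fun i hi => (measurable_v hi).comp hX
  refine (lintegral_mono fun ω => ENNReal.ofReal_le_ofReal (hle ω)).trans ?_
  refine (lintegral_ofReal_affine_le (hC.norm.pow_const 2) (fun _ => sq_nonneg _) (by positivity)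
    zero_le_two (by positivity)
    (H.lintegral_norm_sq_chain_initState_le hF w c.K le_rfl)).trans (le_of_eq ?_)
  rw [Constants.initCoef, add_comm]

end Initial

end Problem

end SMVR

namespace SMVR

namespace Problem

/-! ### Independence of the samples and random times. -/

section Sources

variable {Ω Ξ : Type*} [MeasurableSpace Ξ]

/-- The σ-algebras of the single samples and of the single random times. -/
@[reducible] def source (ξ : ℕ → ℕ → ℕ → Ω → Ξ) (τ : ℕ → Ω → ℕ) :
    (ℕ × ℕ × ℕ) ⊕ ℕ → MeasurableSpace Ω
  | .inl p => MeasurableSpace.comap (ξ p.1 p.2.1 p.2.2) inferInstance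
  | .inr s => MeasurableSpace.comap (τ s) inferInstance

/-- The σ-algebra generated by a set of samples and random times. -/
@[reducible] def info (ξ : ℕ → ℕ → ℕ → Ω → Ξ) (τ : ℕ → Ω → ℕ) (S : Set ((ℕ × ℕ × ℕ) ⊕ ℕ)) :
    MeasurableSpace Ω :=
  ⨆ i ∈ S, source ξ τ i

variable {ξ : ℕ → ℕ → ℕ → Ω → Ξ} {τ : ℕ → Ω → ℕ} {S : Set ((ℕ × ℕ × ℕ) ⊕ ℕ)}

theorem measurable_info_sample {s n i : ℕ} (h : .inl (s, n, i) ∈ S) :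
    Measurable[info ξ τ S] (ξ s n i) :=
  measurable_iff_comap_le.2 <|
    le_iSup₂_of_le (f := fun i (_ : i ∈ S) => source ξ τ i) (.inl (s, n, i)) h le_rfl

theorem measurable_info_time {s : ℕ} (h : .inr s ∈ S) : Measurable[info ξ τ S] (τ s) :=
  measurable_iff_comap_le.2 <|
    le_iSup₂_of_le (f := fun i (_ : i ∈ S) => source ξ τ i) (.inr s) h le_rfl

end Sources

section Sampling

variable {K : ℕ} {Ξ : Type*} [MeasurableSpace Ξ] {P : Problem K Ξ} {Ω : Type*}
  [mΩ : MeasurableSpace Ω] {Pr : Measure Ω} {T : ℕ → ℕ}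
  {ξ : ℕ → ℕ → ℕ → Ω → Ξ} {τ : ℕ → Ω → ℕ}

theorem Sampling.source_le (hS : P.Sampling Pr T ξ τ) (i : (ℕ × ℕ × ℕ) ⊕ ℕ) :
    source ξ τ i ≤ mΩ := by
  rcases i with p | s
  · exact (hS.ξ_meas _ _ _).comap_le
  · exact (hS.τ_meas s).comap_le

theorem Sampling.info_le (hS : P.Sampling Pr T ξ τ) (S : Set ((ℕ × ℕ × ℕ) ⊕ ℕ)) :
    info ξ τ S ≤ mΩ :=
  iSup₂_le fun i _ => hS.source_le i

/-- A finite intersection splits into a sample part and a time part; the two parts are independent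
of each other, and each factorizes. Every later independence claim then reduces to disjointness of
index sets. -/
theorem Sampling.iIndep_source (hS : P.Sampling Pr T ξ τ) : iIndep (source ξ τ) Pr := by
  rw [iIndep_iff]
  intro s f hf
  have hL : ∀ p ∈ s.toLeft, MeasurableSet[source ξ τ (.inl p)] (f (.inl p)) := fun p hp =>
    hf _ (Finset.mem_toLeft.1 hp)
  have hR : ∀ r ∈ s.toRight, MeasurableSet[source ξ τ (.inr r)] (f (.inr r)) := fun r hr =>
    hf _ (Finset.mem_toRight.1 hr)
  have e : (⋂ i ∈ s, f i)
      = (⋂ p ∈ s.toLeft, f (.inl p)) ∩ ⋂ r ∈ s.toRight, f (.inr r) := by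
    ext ω
    simp [Sum.forall]
  have hξ : ∀ p : ℕ × ℕ × ℕ, source ξ τ (.inl p)
      ≤ MeasurableSpace.comap (fun ω (p : ℕ × ℕ × ℕ) => ξ p.1 p.2.1 p.2.2 ω) inferInstance :=
    fun p => measurable_iff_comap_le.1 ((measurable_pi_apply p).comp
      (comap_measurable fun ω (p : ℕ × ℕ × ℕ) => ξ p.1 p.2.1 p.2.2 ω))
  have hτ : ∀ r : ℕ, source ξ τ (.inr r)
      ≤ MeasurableSpace.comap (fun ω r => τ r ω) inferInstance :=
    fun r => measurable_iff_comap_le.1 ((measurable_pi_apply r).comp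
      (comap_measurable fun ω r => τ r ω))
  have hA := Finset.measurableSet_biInter s.toLeft fun p hp => hξ p _ (hL p hp)
  have hB := Finset.measurableSet_biInter s.toRight fun r hr => hτ r _ (hR r hr)
  rw [e, (IndepFun_iff _ _ Pr).1 hS.ξ_τ_indep _ _ hA hB,
    (iIndep_iff _ Pr).1 hS.ξ_indep.iIndep s.toLeft (f := fun p => f (.inl p)) hL,
    (iIndep_iff _ Pr).1 hS.τ_indep.iIndep s.toRight (f := fun r => f (.inr r)) hR,
    ← Finset.prod_disjSum s.toLeft s.toRight fun i => Pr (f i), Finset.toLeft_disjSum_toRight]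

theorem Sampling.indepFun (hS : P.Sampling Pr T ξ τ) {A B : Set ((ℕ × ℕ × ℕ) ⊕ ℕ)}
    (hAB : Disjoint A B) {α β : Type*} [MeasurableSpace α] [MeasurableSpace β] {X : Ω → α}
    {Y : Ω → β} (hX : Measurable[info ξ τ A] X) (hY : Measurable[info ξ τ B] Y) :
    IndepFun X Y Pr :=
  indepFun_of_iIndep hS.source_le hS.iIndep_source hAB hX hY

/-- The prescribed masses at the `T s` time steps already add up to 1, so nothing is left for other
values. -/
theorem Sampling.map_time_singleton [IsProbabilityMeasure Pr] (hS : P.Sampling Pr T ξ τ) {s : ℕ}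
    (hs : 1 ≤ s) (hT : 0 < T s) (n : ℕ) :
    Pr.map (τ s) {n} = if n < T s then (T s : ℝ≥0∞)⁻¹ else 0 := by
  have hlt : ∀ n < T s, Pr.map (τ s) {n} = (T s : ℝ≥0∞)⁻¹ := fun n hn => by
    rw [Measure.map_apply (hS.τ_meas s) (measurableSet_singleton n), hS.τ_law s hs n hn]
  split_ifs with h
  · exact hlt n h
  · have : IsProbabilityMeasure (Pr.map (τ s)) :=
      Measure.isProbabilityMeasure_map (hS.τ_meas s).aemeasurable
    have h1 : Pr.map (τ s) (Finset.range (T s)) = 1 := by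
      rw [← sum_measure_singleton, Finset.sum_congr rfl fun n hn => hlt n (Finset.mem_range.1 hn)]
      simp only [Finset.sum_const, Finset.card_range, nsmul_eq_mul]
      exact ENNReal.mul_inv_cancel (by exact_mod_cast hT.ne') (ENNReal.natCast_ne_top _)
    refine measure_mono_null (t := (Finset.range (T s) : Set ℕ)ᶜ) (by simpa using h) ?_
    exact (prob_compl_eq_zero_iff (Finset.measurableSet _)).2 h1

end Sampling

/-! ### One stage of the algorithm. -/

section Stage

variable {c : Constants} {Ξ : Type*} [MeasurableSpace Ξ] {P : Problem c.K Ξ}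
  {Ω : Type*} {ξ : ℕ → ℕ → ℕ → Ω → Ξ} {τ : ℕ → Ω → ℕ}

variable (P ξ τ) in
/-- The state that stage `s` returns, as a random variable. -/
noncomputable def ret (μ a : ℝ) (η : ℕ → ℝ) (w₀ : Vec (P.d 0)) (s : ℕ) (ω : Ω) : P.State :=
  P.stagewise c.Lf μ a η w₀ (fun s n i => ξ s n i ω) (fun s => τ s ω) s

variable (P ξ τ) in
/-- The state after `n` updates of stage `s + 1`, as a random variable. -/
noncomputable def path (μ a : ℝ) (η : ℕ → ℝ) (w₀ : Vec (P.d 0)) (s n : ℕ) (ω : Ω) : P.State :=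
  P.smvr c.Lf μ a (η (s + 1)) (P.ret ξ τ μ a η w₀ s ω) (fun n i => ξ (s + 1) n i ω) n

theorem Assumptions.measurable_ret (H : P.Assumptions c) (μ a : ℝ) (η : ℕ → ℝ)
    (w₀ : Vec (P.d 0)) {S : Set ((ℕ × ℕ × ℕ) ⊕ ℕ)} (s : ℕ)
    (hξ : ∀ r ≤ s, ∀ n i, .inl (r, n, i) ∈ S) (hτ : ∀ r ≤ s, .inr r ∈ S) :
    Measurable[info ξ τ S] (P.ret ξ τ μ a η w₀ s) :=
  @Assumptions.measurable_stagewise c Ξ _ P H c.Lf μ a η w₀ Ω (info ξ τ S)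
    (fun ω s n i => ξ s n i ω) (fun ω s => τ s ω) s
    (fun r hr n i => measurable_info_sample (hξ r hr n i))
    (fun r hr => measurable_info_time (hτ r hr))

theorem Assumptions.measurable_path (H : P.Assumptions c) (μ a : ℝ) (η : ℕ → ℝ)
    (w₀ : Vec (P.d 0)) {S : Set ((ℕ × ℕ × ℕ) ⊕ ℕ)} (s n : ℕ)
    (hξ : ∀ r ≤ s, ∀ n i, .inl (r, n, i) ∈ S) (hτ : ∀ r ≤ s, .inr r ∈ S)
    (hξ' : ∀ m < n, ∀ i, .inl (s + 1, m, i) ∈ S) :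
    Measurable[info ξ τ S] (P.path ξ τ μ a η w₀ s n) :=
  @Assumptions.measurable_smvr c Ξ _ P H c.Lf μ a (η (s + 1)) Ω (info ξ τ S)
    (P.ret ξ τ μ a η w₀ s) (fun ω n i => ξ (s + 1) n i ω) (H.measurable_ret μ a η w₀ s hξ hτ) n
    (fun m hm i => measurable_info_sample (hξ' m hm i))

theorem clipErr_path_le (μ a : ℝ) (η : ℕ → ℝ) (w₀ : Vec (P.d 0)) (s : ℕ) (ω : Ω) :
    ∀ n, P.clipErr (P.path ξ τ μ a η w₀ s n ω) ≤ P.clipErr (P.ret ξ τ μ a η w₀ s ω)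
  | 0 => le_rfl
  | _ + 1 => (P.clipErr_step _ _ _ _ _).trans_le (P.clipErr_nonneg _)

/-- Either some update has occurred, and the error is zero, or every stage returned its first time
step and the state is still the initial one. -/
theorem clipErr_ret_le (μ a : ℝ) (η : ℕ → ℝ) (w₀ : Vec (P.d 0)) (ω : Ω) :
    ∀ s, P.clipErr (P.ret ξ τ μ a η w₀ s ω) ≤ P.clipErr (P.ret ξ τ μ a η w₀ 0 ω)
  | 0 => le_rfl
  | s + 1 => (clipErr_path_le μ a η w₀ s ω (τ (s + 1) ω)).trans (clipErr_ret_le μ a η w₀ ω s)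

variable [mΩ : MeasurableSpace Ω] {Pr : Measure Ω} {T : ℕ → ℕ}

theorem Sampling.fresh (hS : P.Sampling Pr T ξ τ) (s n : ℕ) :
    P.Fresh Pr (ξ s n) where
  meas := hS.ξ_meas s n
  law := hS.ξ_law s n
  indep := hS.ξ_indep.precomp (g := fun i => (s, n, i)) fun i j h => by simpa using h

theorem Assumptions.measurable_path' (H : P.Assumptions c) (hS : P.Sampling Pr T ξ τ) (μ a : ℝ)
    (η : ℕ → ℝ) (w₀ : Vec (P.d 0)) (s n : ℕ) : Measurable (P.path ξ τ μ a η w₀ s n) :=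
  (H.measurable_path μ a η w₀ (S := Set.univ) s n (fun _ _ _ _ => trivial) (fun _ _ => trivial)
    fun _ _ _ => trivial).mono (hS.info_le _) le_rfl

theorem Assumptions.measurable_ret' (H : P.Assumptions c) (hS : P.Sampling Pr T ξ τ) (μ a : ℝ)
    (η : ℕ → ℝ) (w₀ : Vec (P.d 0)) (s : ℕ) : Measurable (P.ret ξ τ μ a η w₀ s) :=
  H.measurable_path' hS μ a η w₀ s 0

variable [IsProbabilityMeasure Pr]

/-- The samples of an update are independent of the state that they update. -/
theorem Assumptions.lintegral_path_succ (H : P.Assumptions c) (hS : P.Sampling Pr T ξ τ) (μ a : ℝ)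
    (η : ℕ → ℝ) (w₀ : Vec (P.d 0)) (s n : ℕ) {f : P.State → ℝ≥0∞} (hf : Measurable f) :
    ∫⁻ ω, f (P.path ξ τ μ a η w₀ s (n + 1) ω) ∂Pr
      = ∫⁻ ω, ∫⁻ ω', f (P.step c.Lf μ (η (s + 1)) (a * η (s + 1) ^ 2)
          (P.path ξ τ μ a η w₀ s n ω) (fun i => ξ (s + 1) n i ω')) ∂Pr ∂Pr := by
  have hZ : Measurable fun ω i => ξ (s + 1) n i ω := measurable_pi_lambda _ fun i => hS.ξ_meas _ _ i
  have hind : IndepFun (P.path ξ τ μ a η w₀ s n) (fun ω i => ξ (s + 1) n i ω) Pr := by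
    -- The state depends on earlier stages and on the updates before `n` of the current stage. The
    -- set `A` also contains every random time, which does no harm.
    refine hS.indepFun
      (A := {p | ∀ q, p = .inl q → q.1 ≤ s ∨ q.1 = s + 1 ∧ q.2.1 < n})
      (B := {p | ∃ i, p = .inl (s + 1, n, i)}) ?_
      (H.measurable_path μ a η w₀ s n ?_ ?_ ?_)
      (@measurable_pi_lambda _ _ _ (info ξ τ _) _ _ fun i => measurable_info_sample ⟨i, rfl⟩)
    · rw [Set.disjoint_left]
      rintro p hp ⟨i, rfl⟩
      have := hp _ rfl
      simp at this
    · rintro r hr m i q hq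
      obtain rfl := Sum.inl.inj hq
      exact Or.inl hr
    · rintro r - q hq
      cases hq
    · rintro m hm i q hq
      obtain rfl := Sum.inl.inj hq
      exact Or.inr ⟨rfl, hm⟩
  have hstep : Measurable fun p : P.State × (ℕ → Ξ) =>
      f (P.step c.Lf μ (η (s + 1)) (a * η (s + 1) ^ 2) p.1 p.2) :=
    hf.comp (H.measurable_step _ _ _ _ measurable_fst
      fun j => (measurable_pi_apply j).comp measurable_snd)
  refine (lintegral_comp_of_indepFun (H.measurable_path' hS μ a η w₀ s n) hZ hind hstep).trans ?_
  refine lintegral_congr fun ω => ?_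
  exact lintegral_map (f := fun z => f (P.step c.Lf μ (η (s + 1)) (a * η (s + 1) ^ 2)
    (P.path ξ τ μ a η w₀ s n ω) z)) (hstep.comp measurable_prodMk_left) hZ

/-- The returned time step is uniform and independent of the path of the stage. -/
theorem Assumptions.lintegral_ret_succ (H : P.Assumptions c) (hS : P.Sampling Pr T ξ τ) (μ a : ℝ)
    (η : ℕ → ℝ) (w₀ : Vec (P.d 0)) (s : ℕ) (hT : 0 < T (s + 1)) {f : P.State → ℝ≥0∞}
    (hf : Measurable f) :
    ∫⁻ ω, f (P.ret ξ τ μ a η w₀ (s + 1) ω) ∂Pr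
      = (∑ n ∈ Finset.range (T (s + 1)), ∫⁻ ω, f (P.path ξ τ μ a η w₀ s n ω) ∂Pr)
        * (T (s + 1) : ℝ≥0∞)⁻¹ := by
  have hind : IndepFun (fun ω n => P.path ξ τ μ a η w₀ s n ω) (τ (s + 1)) Pr := by
    refine hS.indepFun (A := {p | p ≠ .inr (s + 1)}) (B := {.inr (s + 1)}) ?_
      (@measurable_pi_lambda _ _ _ (info ξ τ _) _ _ fun n =>
        H.measurable_path μ a η w₀ s n ?_ ?_ ?_)
      (measurable_info_time rfl)
    · simp
    · simp
    · intro r hr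
      simp
      omega
    · simp
  have hpath := H.measurable_path' hS μ a η w₀ s
  -- The whole path is one random variable, and the returned state is its evaluation at an
  -- independent time.
  have hm : Measurable fun p : (ℕ → P.State) × ℕ => f (p.1 p.2) :=
    measurable_from_prod_countable_left fun n => hf.comp (measurable_pi_apply n)
  have h := lintegral_comp_of_indepFun (measurable_pi_lambda _ hpath) (hS.τ_meas (s + 1)) hind hm
  refine h.trans ?_
  simp only [lintegral_countable', hS.map_time_singleton (Nat.le_add_left 1 s) hT]
  have hfp : ∀ n, Measurable fun ω => f (P.path ξ τ μ a η w₀ s n ω) := fun n => hf.comp (hpath n)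
  rw [lintegral_tsum fun n => ((hfp n).mul_const _).aemeasurable,
    tsum_eq_sum (s := Finset.range (T (s + 1))) fun n hn => by
      rw [if_neg (by simpa using hn)]; simp, Finset.sum_mul]
  refine Finset.sum_congr rfl fun n hn => ?_
  rw [if_pos (Finset.mem_range.1 hn), lintegral_mul_const _ (hfp n)]

theorem Assumptions.lintegral_clipErr_ret_le (H : P.Assumptions c) (hS : P.Sampling Pr T ξ τ)
    (μ a : ℝ) (η : ℕ → ℝ) (w₀ : Vec (P.d 0)) (s : ℕ) :
    ∫⁻ ω, ENNReal.ofReal (P.clipErr (P.ret ξ τ μ a η w₀ s ω)) ∂Pr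
      ≤ ENNReal.ofReal c.initCoef :=
  (lintegral_mono fun ω => ENNReal.ofReal_le_ofReal (clipErr_ret_le μ a η w₀ ω s)).trans
    (H.lintegral_clipErr_initState_le (hS.fresh 0 0) w₀)

/-- The residuals along a stage. -/
theorem Assumptions.sum_lintegral_resid_path_le (H : P.Assumptions c)
    (hS : P.Sampling Pr T ξ τ) {μ L : ℝ} {η : ℕ → ℝ} (w₀ : Vec (P.d 0)) (s : ℕ)
    (hb : BddBelow (Set.range (P.reg μ))) (hμ : 0 ≤ μ) (hη : 0 < η (s + 1)) (hL : 0 < L)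
    (hs : η (s + 1) * (c.smoothCoef + μ) ≤ 1 / 4) (hC : c.trackCoef ≤ L)
    (hg : c.biasCoef ≤ 4 * L) (hβ : 16 * L ^ 2 * η (s + 1) ^ 2 * (1 + c.trackCoef) ≤ 1) (N : ℕ) :
    ∑ n ∈ Finset.range N, ∫⁻ ω, ENNReal.ofReal (η (s + 1) / 2
        * P.resid μ L (P.path ξ τ μ (16 * L ^ 2) η w₀ s n ω)) ∂Pr
      ≤ ∫⁻ ω, ENNReal.ofReal (P.energy μ (1 / (4 * L * η (s + 1)))
          (P.ret ξ τ μ (16 * L ^ 2) η w₀ s ω)) ∂Pr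
        + ∫⁻ ω, ENNReal.ofReal (η (s + 1) / 2
            * P.clipErr (P.ret ξ τ μ (16 * L ^ 2) η w₀ s ω)) ∂Pr
        + N * ENNReal.ofReal (1 / (4 * L * η (s + 1)) * c.trackCoef
            * (16 * L ^ 2 * η (s + 1) ^ 2) ^ 2 * c.noise) := by
  set Y := P.path ξ τ μ (16 * L ^ 2) η w₀ s
  set E : P.State → ℝ≥0∞ := fun x => ENNReal.ofReal (P.energy μ (1 / (4 * L * η (s + 1))) x)
  set W : P.State → ℝ≥0∞ := fun x => ENNReal.ofReal (η (s + 1) / 2 * P.clipErr x)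
  set R : P.State → ℝ≥0∞ := fun x => ENNReal.ofReal (η (s + 1) / 2 * P.resid μ L x)
  set k := ENNReal.ofReal (1 / (4 * L * η (s + 1)) * c.trackCoef
            * (16 * L ^ 2 * η (s + 1) ^ 2) ^ 2 * c.noise)
  have hE : Measurable E := (H.measurable_energy _ _).ennreal_ofReal
  have hW : Measurable W := (H.measurable_clipErr.const_mul _).ennreal_ofReal
  have hR : Measurable R := ((H.measurable_resid μ L).const_mul _).ennreal_ofReal
  have hY : ∀ n, Measurable (Y n) := H.measurable_path' hS μ (16 * L ^ 2) η w₀ s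
  have hRY : ∀ n, Measurable fun ω => R (Y n ω) := fun n => hR.comp (hY n)
  have hWY : ∀ n, Measurable fun ω => W (Y n ω) := fun n => hW.comp (hY n)
  have hone : ∀ n, ∫⁻ ω, E (Y (n + 1) ω) ∂Pr + ∫⁻ ω, R (Y n ω) ∂Pr
      ≤ ∫⁻ ω, E (Y n ω) ∂Pr + ∫⁻ ω, W (Y n ω) ∂Pr + k := by
    intro n
    rw [H.lintegral_path_succ hS μ (16 * L ^ 2) η w₀ s n hE,
      ← lintegral_add_right _ (hRY n)]
    refine (lintegral_mono fun ω => H.lintegral_energy_step_le (hS.fresh (s + 1) n) hb hμ hη hL hs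
      hC hg hβ (Y n ω)).trans (le_of_eq ?_)
    rw [lintegral_add_right _ measurable_const, lintegral_add_right _ (hWY n),
      lintegral_const, measure_univ, mul_one]
  have hW0 : ∀ n, ∫⁻ ω, W (Y (n + 1) ω) ∂Pr = 0 := fun n => by
    have : ∀ ω, W (Y (n + 1) ω) = 0 := fun ω => by
      have h0 : P.clipErr (Y (n + 1) ω) = 0 := P.clipErr_step _ _ _ _ _
      simp only [W, h0, mul_zero, ENNReal.ofReal_zero]
    simp [this]
  -- Keeping `W (Y n)` on the left makes the induction close: it is charged once, at time 0, and is
  -- zero after every update.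
  have key : ∀ n : ℕ, ∫⁻ ω, E (Y n ω) ∂Pr + ∫⁻ ω, W (Y n ω) ∂Pr
      + ∑ m ∈ Finset.range n, ∫⁻ ω, R (Y m ω) ∂Pr
      ≤ ∫⁻ ω, E (Y 0 ω) ∂Pr + ∫⁻ ω, W (Y 0 ω) ∂Pr + n * k := by
    intro n
    induction n with
    | zero => simp
    | succ n ih =>
      rw [hW0, add_zero, Finset.sum_range_succ, add_comm (∑ m ∈ Finset.range n, _), ← add_assoc]
      refine (add_le_add_left (hone n) _).trans ?_
      calc ∫⁻ ω, E (Y n ω) ∂Pr + ∫⁻ ω, W (Y n ω) ∂Pr + k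
            + ∑ m ∈ Finset.range n, ∫⁻ ω, R (Y m ω) ∂Pr
          = ∫⁻ ω, E (Y n ω) ∂Pr + ∫⁻ ω, W (Y n ω) ∂Pr
            + ∑ m ∈ Finset.range n, ∫⁻ ω, R (Y m ω) ∂Pr + k := by ring
        _ ≤ ∫⁻ ω, E (Y 0 ω) ∂Pr + ∫⁻ ω, W (Y 0 ω) ∂Pr + n * k + k := by gcongr
        _ = _ := by push_cast; ring
  exact le_trans le_add_self (key N)

/-- The residual of the state that a stage returns. -/
theorem Assumptions.lintegral_resid_ret_le (H : P.Assumptions c)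
    (hS : P.Sampling Pr T ξ τ) {μ L : ℝ} {η : ℕ → ℝ} (w₀ : Vec (P.d 0)) (s : ℕ)
    (hT : 0 < T (s + 1))
    (hb : BddBelow (Set.range (P.reg μ))) (hμ : 0 ≤ μ) (hη : 0 < η (s + 1)) (hL : 0 < L)
    (hs : η (s + 1) * (c.smoothCoef + μ) ≤ 1 / 4) (hC : c.trackCoef ≤ L)
    (hg : c.biasCoef ≤ 4 * L) (hβ : 16 * L ^ 2 * η (s + 1) ^ 2 * (1 + c.trackCoef) ≤ 1)
    {e : ℝ} (he0 : 0 ≤ e)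
    (he : ∫⁻ ω, ENNReal.ofReal (P.energy μ (1 / (4 * L * η (s + 1)))
          (P.ret ξ τ μ (16 * L ^ 2) η w₀ s ω)) ∂Pr ≤ ENNReal.ofReal e) :
    ∫⁻ ω, ENNReal.ofReal (P.resid μ L (P.ret ξ τ μ (16 * L ^ 2) η w₀ (s + 1) ω)) ∂Pr
      ≤ ENNReal.ofReal (2 * e / (η (s + 1) * T (s + 1)) + c.initCoef / T (s + 1)
        + 8 * L * c.trackCoef * (16 * L ^ 2 * η (s + 1) ^ 2) * c.noise) := by
  have hsum := H.sum_lintegral_resid_path_le hS w₀ s hb hμ hη hL hs hC hg hβ (T (s + 1))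
  have hC0 := c.trackCoef_nonneg
  have hn := c.noise_nonneg
  have hi := c.initCoef_nonneg
  have hTr : (0 : ℝ) < T (s + 1) := by exact_mod_cast hT
  have hR : Measurable fun x => ENNReal.ofReal (P.resid μ L x) :=
    (H.measurable_resid μ L).ennreal_ofReal
  have hclip : ∫⁻ ω, ENNReal.ofReal (η (s + 1) / 2
      * P.clipErr (P.ret ξ τ μ (16 * L ^ 2) η w₀ s ω)) ∂Pr
      ≤ ENNReal.ofReal (η (s + 1) / 2 * c.initCoef) := by
    have := lintegral_ofReal_affine_le (Pr := Pr)
      (H.measurable_clipErr.comp (H.measurable_ret' hS μ (16 * L ^ 2) η w₀ s))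
      (fun _ => P.clipErr_nonneg _) le_rfl (by positivity : 0 ≤ η (s + 1) / 2) hi
      (H.lintegral_clipErr_ret_le hS μ (16 * L ^ 2) η w₀ s)
    simpa using this
  have hmul : ∀ n, ∫⁻ ω, ENNReal.ofReal (η (s + 1) / 2
        * P.resid μ L (P.path ξ τ μ (16 * L ^ 2) η w₀ s n ω)) ∂Pr
      = ENNReal.ofReal (η (s + 1) / 2) * ∫⁻ ω, ENNReal.ofReal
        (P.resid μ L (P.path ξ τ μ (16 * L ^ 2) η w₀ s n ω)) ∂Pr := fun n => by
    have hRp : Measurable fun ω => ENNReal.ofReal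
        (P.resid μ L (P.path ξ τ μ (16 * L ^ 2) η w₀ s n ω)) :=
      hR.comp (H.measurable_path' hS μ (16 * L ^ 2) η w₀ s n)
    rw [← lintegral_const_mul _ hRp]
    exact lintegral_congr fun ω => ENNReal.ofReal_mul (by positivity)
  simp only [hmul] at hsum
  rw [← Finset.mul_sum] at hsum
  have hsum' := hsum.trans (add_le_add_left (add_le_add he hclip) _)
  rw [← ENNReal.ofReal_natCast, ← ENNReal.ofReal_mul hTr.le,
    ← ENNReal.ofReal_add he0 (by positivity),
    ← ENNReal.ofReal_add (by positivity) (by positivity)] at hsum'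
  rw [H.lintegral_ret_succ hS μ (16 * L ^ 2) η w₀ s hT hR, ← ENNReal.ofReal_natCast,
    ← ENNReal.ofReal_inv_of_pos hTr]
  -- The telescoped sum carries the weight `η/2`, whereas the uniform average carries `1/T`.
  have hη2 : ENNReal.ofReal (η (s + 1) / 2)⁻¹ * ENNReal.ofReal (η (s + 1) / 2) = 1 := by
    rw [← ENNReal.ofReal_mul (by positivity), inv_mul_cancel₀ (by positivity), ENNReal.ofReal_one]
  calc _ = ENNReal.ofReal (η (s + 1) / 2)⁻¹ * (ENNReal.ofReal (η (s + 1) / 2)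
        * ∑ n ∈ Finset.range (T (s + 1)), ∫⁻ ω, ENNReal.ofReal
          (P.resid μ L (P.path ξ τ μ (16 * L ^ 2) η w₀ s n ω)) ∂Pr)
          * ENNReal.ofReal (T (s + 1) : ℝ)⁻¹ := by rw [← mul_assoc, hη2, one_mul]
    _ ≤ ENNReal.ofReal (η (s + 1) / 2)⁻¹ * ENNReal.ofReal _ * ENNReal.ofReal (T (s + 1) : ℝ)⁻¹ := by
        gcongr
    _ = _ := by
        rw [← ENNReal.ofReal_mul (by positivity), ← ENNReal.ofReal_mul (by positivity)]
        congr 1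
        field_simp
        ring

end Stage

end Problem

end SMVR

namespace SMVR

/-! ### Arithmetic of the parameters and the sample count. -/

namespace Constants

variable (c : Constants)

/-- Smallest admissible value of the parameter `L`. -/
noncomputable def minL : ℝ :=
  1 + 1 / (c.D : ℝ) ^ 2 + c.trackCoef + c.biasCoef + c.smoothCoef + c.initCoef
    + c.trackCoef * c.noise

/-- Bound on the number of steps of the first stage. -/
noncomputable def firstSteps (L : ℝ) : ℝ :=
  2 + 4 * L * c.K * c.noise + 2 * √(2 * L) * (c.Δ + 1 / (c.D : ℝ) ^ 2 / 2 * (c.R : ℝ) ^ 2)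

/-- The factor of `1 / ε ^ 2` in the bound on the number of samples. -/
noncomputable def sampleCoef (L : ℝ) : ℝ :=
  c.K * ((c.firstSteps L + 1 + 256 * L ^ 2) * (64 * L * (c.D : ℝ) ^ 2)
    + 768 * L ^ 2 * (c.D : ℝ) ^ 2 * √(64 * L * (c.D : ℝ) ^ 2))

variable {c}

/-- All requirements on `L`; the quantity `1/D²` bounds `μ` uniformly over `ε ≤ 1`, so the threshold
is free of `ε`. -/
theorem minL_spec {L : ℝ} (h : c.minL ≤ L) :
    1 ≤ L ∧ 1 / (c.D : ℝ) ^ 2 ≤ L ∧ 1 + c.trackCoef ≤ L ∧ c.biasCoef ≤ L ∧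
      c.smoothCoef + 1 / (c.D : ℝ) ^ 2 ≤ L ∧ c.initCoef ≤ L ∧ c.trackCoef * c.noise ≤ L := by
  have h1 : 0 ≤ 1 / (c.D : ℝ) ^ 2 := by positivity
  have h2 := c.trackCoef_nonneg
  have h3 := c.biasCoef_nonneg
  have h4 := c.smoothCoef_nonneg
  have h5 := c.initCoef_nonneg
  have h6 := mul_nonneg h2 c.noise_nonneg
  unfold minL at h
  refine ⟨?_, ?_, ?_, ?_, ?_, ?_, ?_⟩ <;> linarith

variable {L ε : ℝ}

theorem D_sq_pos : 0 < (c.D : ℝ) ^ 2 := by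
  have : (0 : ℝ) < c.D := c.D_pos
  positivity

theorem mu_pos (hε : 0 < ε) : 0 < c.mu ε := div_pos hε D_sq_pos

theorem mu_le (hε1 : ε ≤ 1) : c.mu ε ≤ 1 / (c.D : ℝ) ^ 2 :=
  div_le_div_of_nonneg_right hε1 (sq_nonneg _)

/-- The product no longer depends on `ε`. The residual targets, momenta and learning rates are
therefore the same for every accuracy. -/
theorem mu_mul_acc (hε : 0 < ε) (s : ℕ) : c.mu ε * c.acc L ε (s + 1) = 8 * L / 2 ^ s := by
  have := (mu_pos (c := c) hε).ne'
  rw [acc, Nat.add_sub_cancel]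
  field_simp

theorem mu_mul_acc_succ (hε : 0 < ε) (s : ℕ) :
    2 * (c.mu ε * c.acc L ε (s + 2)) = c.mu ε * c.acc L ε (s + 1) := by
  rw [mu_mul_acc hε, mu_mul_acc hε, pow_succ]
  field_simp

theorem beta_one : c.beta L ε 1 = 1 / (2 * L) := if_pos rfl

theorem beta_succ (s : ℕ) :
    c.beta L ε (s + 2) = c.mu ε * c.acc L ε (s + 1) / (64 * L ^ 2) := by
  rw [beta, if_neg (by omega)]
  rfl

theorem beta_pos (hL : 1 ≤ L) (hε : 0 < ε) (s : ℕ) : 0 < c.beta L ε (s + 1) := by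
  rcases s with _ | s
  · rw [beta_one]; positivity
  · rw [beta_succ, mu_mul_acc hε]; positivity

theorem beta_le (hL : 1 ≤ L) (hε : 0 < ε) (s : ℕ) : c.beta L ε (s + 1) ≤ 1 / L := by
  have hL0 : 0 < L := by linarith
  rcases s with _ | s
  · rw [beta_one]
    exact one_div_le_one_div_of_le hL0 (by linarith)
  · rw [beta_succ, mu_mul_acc hε, div_div, div_le_div_iff₀ (by positivity) hL0]
    have : (1 : ℝ) ≤ 2 ^ s := one_le_pow₀ one_le_two
    nlinarith [mul_le_mul_of_nonneg_right this (sq_nonneg L)]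

theorem eta_pos (hL : 1 ≤ L) (hε : 0 < ε) (s : ℕ) : 0 < c.eta L ε (s + 1) := by
  have := beta_pos (c := c) hL hε s
  exact Real.sqrt_pos.2 (by positivity)

theorem eta_sq (hL : 1 ≤ L) (hε : 0 < ε) (s : ℕ) :
    16 * L ^ 2 * c.eta L ε (s + 1) ^ 2 = c.beta L ε (s + 1) := by
  have := beta_pos (c := c) hL hε s
  have hL0 : L ≠ 0 := by linarith
  rw [eta, Real.sq_sqrt (by positivity)]
  field_simp

theorem eta_le (hL : 1 ≤ L) (hε : 0 < ε) (s : ℕ) : c.eta L ε (s + 1) ≤ 1 / (4 * L) := by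
  have h1 := eta_sq (c := c) hL hε s
  have h2 := beta_le (c := c) hL hε s
  have h3 : 1 / L ≤ 1 := (div_le_one (by linarith)).2 hL
  have h4 := (eta_pos (c := c) hL hε s).le
  rw [le_div_iff₀ (by linarith)]
  by_contra hlt
  push Not at hlt
  nlinarith

theorem rpow_three_halves {x : ℝ} (hx : 0 ≤ x) : x ^ (3 / 2 : ℝ) = x * √x := by
  rcases hx.eq_or_lt with rfl | hx
  · rw [Real.zero_rpow (by norm_num), zero_mul]
  · rw [Real.sqrt_eq_rpow, ← Real.rpow_one_add' hx.le (by norm_num)]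
    norm_num

theorem steps_one : c.steps L ε 1
    = max 1 ⌈max (4 * L * c.K * c.noise) (2 * √(2 * L) * c.gap ε)⌉₊ := if_pos rfl

/-- Removes the exponents `3/2` and expresses everything through `q = μ ε_s` and `μ`, the form used
in the stage bounds. -/
theorem steps_succ (hL : 0 ≤ L) (hε : 0 < ε) (s : ℕ) : c.steps L ε (s + 2)
    = ⌈max (2048 * L ^ 3 / (c.mu ε * c.acc L ε (s + 1)))
      (256 * L ^ 2 / (c.mu ε * √(c.mu ε * c.acc L ε (s + 1))))⌉₊ := by
  have hμ := (mu_pos (c := c) hε).le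
  have h1 : (64 * L ^ 2) ^ (3 / 2 : ℝ) = 512 * L ^ 3 := by
    have : (64 * L ^ 2 : ℝ) = (8 * L) ^ 2 := by ring
    rw [rpow_three_halves (by positivity), this, Real.sqrt_sq (by positivity)]
    ring
  rw [steps, if_neg (by omega), h1, rpow_three_halves hμ, Real.sqrt_mul hμ, mul_assoc (c.mu ε)]
  congr 3 <;> ring

theorem steps_pos (hL : 1 ≤ L) (hε : 0 < ε) (s : ℕ) : 0 < c.steps L ε (s + 1) := by
  rcases s with _ | s
  · rw [steps_one]; exact lt_max_of_lt_left one_pos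
  · rw [steps_succ (by linarith) hε, mu_mul_acc hε]
    exact Nat.ceil_pos.2 (lt_max_of_lt_left (by positivity))

theorem gap_nonneg (hε : 0 < ε) : 0 ≤ c.gap ε := by
  have := (mu_pos (c := c) hε).le
  unfold gap; positivity

/-- The parameters of the first stage bring the residual down to its target. -/
theorem first_stage_bound (hL : c.minL ≤ L) (hε : 0 < ε) :
    2 * (c.gap ε + 1 / (4 * L * c.eta L ε 1) * (c.K * c.noise))
        / (c.eta L ε 1 * c.steps L ε 1) + c.initCoef / c.steps L ε 1
        + 8 * L * c.trackCoef * (16 * L ^ 2 * c.eta L ε 1 ^ 2) * c.noise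
      ≤ 2 * (c.mu ε * c.acc L ε 1) := by
  obtain ⟨h1, -, -, -, -, hi, hn⟩ := minL_spec hL
  have hL0 : 0 < L := by linarith
  have hη := eta_pos (c := c) h1 hε 0
  have hη2 := eta_sq (c := c) h1 hε 0
  have hg := gap_nonneg (c := c) hε
  have hno := c.noise_nonneg
  simp only [zero_add] at hη hη2
  have hT1 : (1 : ℝ) ≤ c.steps L ε 1 := by exact_mod_cast steps_pos h1 hε 0
  have hTm : max (4 * L * c.K * c.noise) (2 * √(2 * L) * c.gap ε) ≤ c.steps L ε 1 := by
    refine (Nat.le_ceil _).trans ?_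
    rw [steps_one]
    exact_mod_cast le_max_right _ _
  have hTa := (le_max_left _ _).trans hTm
  have hTb := (le_max_right _ _).trans hTm
  rw [hη2, beta_one, mu_mul_acc hε 0]
  rw [beta_one] at hη2
  have hηe : c.eta L ε 1 = 1 / (4 * L * √(2 * L)) := by
    rw [eta, beta_one, div_div, show 2 * L * (16 * L ^ 2) = (4 * L * √(2 * L)) ^ 2 by
      rw [mul_pow, Real.sq_sqrt (by positivity)]; ring, Real.sqrt_div zero_le_one,
      Real.sqrt_one, Real.sqrt_sq (by positivity)]
  set T : ℝ := ((c.steps L ε 1 : ℕ) : ℝ)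
  set r := √(2 * L) with hr
  have hr0 : 0 < r := Real.sqrt_pos.2 (by positivity)
  have hr2 : r ^ 2 = 2 * L := Real.sq_sqrt (by positivity)
  have hT0 : 0 < T := by linarith
  -- With `η = 1/(4L√(2L))`, the two lower bounds on `T` make each summand at most `4L`. Together
  -- with `L` and `4L` from the other terms this gives `13L`, below the target `16L`.
  have e1 : 2 * (c.gap ε + 1 / (4 * L * c.eta L ε 1) * (c.K * c.noise)) / (c.eta L ε 1 * T)
      = 4 * L * (2 * r * c.gap ε / T) + 4 * L * (4 * L * c.K * c.noise / T) := by
    rw [hηe]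
    field_simp
    linear_combination 2 * c.K * c.noise * hr2
  have b1 : 2 * r * c.gap ε / T ≤ 1 := (div_le_one hT0).2 hTb
  have b2 : 4 * L * c.K * c.noise / T ≤ 1 := (div_le_one hT0).2 hTa
  have b3 : c.initCoef / T ≤ L := (div_le_self c.initCoef_nonneg hT1).trans hi
  have e2 : 8 * L * c.trackCoef * (1 / (2 * L)) * c.noise = 4 * (c.trackCoef * c.noise) := by
    field_simp; ring
  have b4 := mul_le_mul_of_nonneg_left b1 (by positivity : 0 ≤ 4 * L)
  have b5 := mul_le_mul_of_nonneg_left b2 (by positivity : 0 ≤ 4 * L)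
  rw [e1, e2, pow_zero, div_one]
  linarith

/-- The parameters of a later stage halve the target of the residual. -/
theorem later_stage_bound (hL : c.minL ≤ L) (hε : 0 < ε) (s : ℕ) :
    2 * ((1 / (2 * c.mu ε) + 1 / (4 * L * c.eta L ε (s + 2)) / (4 * L))
          * (2 * (c.mu ε * c.acc L ε (s + 1))))
        / (c.eta L ε (s + 2) * c.steps L ε (s + 2)) + c.initCoef / c.steps L ε (s + 2)
        + 8 * L * c.trackCoef * (16 * L ^ 2 * c.eta L ε (s + 2) ^ 2) * c.noise
      ≤ 2 * (c.mu ε * c.acc L ε (s + 2)) := by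
  obtain ⟨h1, -, -, -, -, hi, hn⟩ := minL_spec hL
  have hL0 : 0 < L := by linarith
  have hμ := mu_pos (c := c) hε
  have hη2 : 16 * L ^ 2 * c.eta L ε (s + 2) ^ 2 = _ := eta_sq (c := c) h1 hε (s + 1)
  have hT0 : (0 : ℝ) < c.steps L ε (s + 2) := by exact_mod_cast steps_pos h1 hε (s + 1)
  have hq : 0 < c.mu ε * c.acc L ε (s + 1) := by rw [mu_mul_acc hε]; positivity
  have hTm := Nat.le_ceil (max (2048 * L ^ 3 / (c.mu ε * c.acc L ε (s + 1)))
      (256 * L ^ 2 / (c.mu ε * √(c.mu ε * c.acc L ε (s + 1)))))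
  rw [← steps_succ hL0.le hε] at hTm
  have hTa := (le_max_left _ _).trans hTm
  have hTb := (le_max_right _ _).trans hTm
  rw [mu_mul_acc_succ hε, hη2, beta_succ]
  have hηe : c.eta L ε (s + 2) = √(c.mu ε * c.acc L ε (s + 1)) / (32 * L ^ 2) := by
    rw [eta, beta_succ, div_div, show 64 * L ^ 2 * (16 * L ^ 2) = (32 * L ^ 2) ^ 2 by ring,
      Real.sqrt_div hq.le, Real.sqrt_sq (by positivity)]
  set T : ℝ := ((c.steps L ε (s + 2) : ℕ) : ℝ)
  set q := c.mu ε * c.acc L ε (s + 1)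
  set r := √q
  have hr0 : 0 < r := Real.sqrt_pos.2 hq
  have hr2 : q = r ^ 2 := (Real.sq_sqrt hq.le).symm
  rw [div_le_iff₀ hq] at hTa
  rw [div_le_iff₀ (by positivity)] at hTb
  -- Here `η = √q/(32L²)`, and the target is `q`. The gap part is at most `q/4` and the tracking
  -- part, the clipping part and the noise part at most `q/8` each.
  have e1 : 2 * ((1 / (2 * c.mu ε) + 1 / (4 * L * c.eta L ε (s + 2)) / (4 * L)) * (2 * q))
      / (c.eta L ε (s + 2) * T) = 64 * L ^ 2 * r / (c.mu ε * T) + 256 * L ^ 2 / T := by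
    rw [hηe, hr2]
    field_simp
    ring
  have b1 : 64 * L ^ 2 * r / (c.mu ε * T) ≤ q / 4 := by
    rw [div_le_iff₀ (by positivity), hr2]
    nlinarith
  have b2 : 256 * L ^ 2 / T ≤ q / 8 := by
    rw [div_le_iff₀ hT0]
    nlinarith [mul_le_mul_of_nonneg_right h1 (sq_nonneg L)]
  have b3 : c.initCoef / T ≤ q / 8 := by
    refine le_trans ?_ b2
    gcongr
    nlinarith
  have b4 : 8 * L * c.trackCoef * (q / (64 * L ^ 2)) * c.noise ≤ q / 8 := by
    have : 8 * L * c.trackCoef * (q / (64 * L ^ 2)) * c.noise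
        = q / 8 * (c.trackCoef * c.noise / L) := by field_simp; ring
    rw [this]
    exact mul_le_of_le_one_right (by positivity) ((div_le_one hL0).2 hn)
  rw [e1]
  linarith

theorem acc_ratio (hε : 0 < ε) :
    2 * c.acc L ε 1 / (ε / 2) = 32 * L * (c.D : ℝ) ^ 2 / ε ^ 2 := by
  have hD : (0 : ℝ) < c.D := c.D_pos
  have h2 : c.acc L ε 1 = 8 * L * (c.D : ℝ) ^ 2 / ε := by
    rw [acc, mu, Nat.sub_self, pow_zero, div_one]
    field_simp
  rw [h2]
  field_simp
  ring

theorem one_lt_ratio (hL : c.minL ≤ L) (hε : 0 < ε) (hε1 : ε ≤ 1) :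
    1 < 32 * L * (c.D : ℝ) ^ 2 / ε ^ 2 := by
  obtain ⟨-, h2, -⟩ := minL_spec hL
  rw [div_le_iff₀ D_sq_pos] at h2
  rw [lt_div_iff₀ (by positivity)]
  nlinarith

theorem stages_pos (hL : c.minL ≤ L) (hε : 0 < ε) (hε1 : ε ≤ 1) : 0 < c.stages L ε := by
  rw [stages, acc_ratio hε]
  exact Nat.ceil_pos.2 (Real.logb_pos one_lt_two (one_lt_ratio hL hε hε1))

theorem ratio_le_two_pow_stages (hL : c.minL ≤ L) (hε : 0 < ε) (hε1 : ε ≤ 1) :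
    32 * L * (c.D : ℝ) ^ 2 / ε ^ 2 ≤ 2 ^ c.stages L ε := by
  have h := one_lt_ratio hL hε hε1
  have h2 := Nat.le_ceil (Real.logb 2 (2 * c.acc L ε 1 / (ε / 2)))
  rw [acc_ratio hε, Real.logb_le_iff_le_rpow one_lt_two (by linarith)] at h2
  rw [stages, acc_ratio hε]
  exact_mod_cast h2

theorem two_pow_stages_le (hL : c.minL ≤ L) (hε : 0 < ε) (hε1 : ε ≤ 1) :
    (2 : ℝ) ^ c.stages L ε ≤ 64 * L * (c.D : ℝ) ^ 2 / ε ^ 2 := by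
  have h := one_lt_ratio hL hε hε1
  have h2 := Nat.ceil_lt_add_one (Real.logb_nonneg one_lt_two h.le)
  have h3 : (2 : ℝ) ^ c.stages L ε ≤ (2 : ℝ) ^ (Real.logb 2 (32 * L * (c.D : ℝ) ^ 2 / ε ^ 2) + 1) := by
    rw [← Real.rpow_natCast]
    refine Real.rpow_le_rpow_of_exponent_le one_le_two ?_
    rw [stages, acc_ratio hε]
    exact h2.le
  rw [Real.rpow_add two_pos, Real.rpow_logb two_pos (by norm_num) (by linarith),
    Real.rpow_one] at h3
  refine h3.trans (le_of_eq ?_)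
  ring

/-- The last accuracy is the first divided by `2 ^ (S - 1)`; the factor 2 inside the logarithm
compensates for the missing halving. -/
theorem acc_stages_le (hL : c.minL ≤ L) (hε : 0 < ε) (hε1 : ε ≤ 1) :
    c.acc L ε (c.stages L ε) ≤ ε / 2 := by
  have h1 := ratio_le_two_pow_stages hL hε hε1
  obtain ⟨s, hs⟩ := Nat.exists_eq_succ_of_ne_zero (stages_pos hL hε hε1).ne'
  rw [hs, Nat.succ_eq_add_one] at h1 ⊢
  have hD := (D_sq_pos (c := c))
  have h2 : c.acc L ε (s + 1) = 8 * L * (c.D : ℝ) ^ 2 / ε / 2 ^ s := by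
    rw [acc, mu, Nat.add_sub_cancel]
    field_simp
  rw [h2, div_le_iff₀ (by positivity), div_le_iff₀ hε]
  rw [div_le_iff₀ (by positivity), pow_succ (2 : ℝ) s] at h1
  nlinarith

theorem sqrt_two_pow (j : ℕ) : √((2 : ℝ) ^ j) = √2 ^ j := by
  rw [← Real.sqrt_sq (by positivity : 0 ≤ √2 ^ j), ← pow_mul, mul_comm, pow_mul,
    Real.sq_sqrt two_pos.le]

/-- The first term of the maximum grows like `1/q`, that is `2^j`, and the second like `1/(μ √q)`,
that is `√2^j/ε`; the first stage and the rounding are absorbed into the first term. -/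
theorem steps_le (hL : c.minL ≤ L) (hε : 0 < ε) (hε1 : ε ≤ 1) (j : ℕ) :
    (c.steps L ε (j + 1) : ℝ) ≤ (c.firstSteps L + 1 + 256 * L ^ 2) * 2 ^ j
      + 256 * L ^ 2 * (c.D : ℝ) ^ 2 / ε * √2 ^ j := by
  obtain ⟨h1, -⟩ := minL_spec hL
  have hL0 : 0 < L := by linarith
  have hno := c.noise_nonneg
  have hf : 0 ≤ c.firstSteps L := by unfold firstSteps; positivity
  have hr : (1 : ℝ) ≤ √2 := by rw [Real.one_le_sqrt]; norm_num
  rcases j with _ | j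
  · have hg := gap_nonneg (c := c) hε
    have hA : 0 ≤ 4 * L * c.K * c.noise := by positivity
    have hB : 0 ≤ 2 * √(2 * L) * c.gap ε := by positivity
    have h2 := (Nat.ceil_lt_add_one (hA.trans (le_max_left _ (2 * √(2 * L) * c.gap ε)))).le
    have h3 : max (4 * L * c.K * c.noise) (2 * √(2 * L) * c.gap ε)
        ≤ 4 * L * c.K * c.noise + 2 * √(2 * L) * c.gap ε :=
      max_le (by linarith) (by linarith)
    have h4 : c.gap ε ≤ c.Δ + 1 / (c.D : ℝ) ^ 2 / 2 * (c.R : ℝ) ^ 2 := by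
      unfold gap
      gcongr
      exact mu_le hε1
    have h5 := mul_le_mul_of_nonneg_left h4 (by positivity : 0 ≤ 2 * √(2 * L))
    have h6 : (c.steps L ε 1 : ℝ) ≤ c.firstSteps L := by
      rw [steps_one, firstSteps, Nat.cast_max]
      refine max_le ?_ (by linarith)
      push_cast
      linarith
    have h7 : 0 ≤ 256 * L ^ 2 * (c.D : ℝ) ^ 2 / ε := by positivity
    simp only [zero_add, pow_zero, mul_one]
    nlinarith [sq_nonneg L]
  · rw [steps_succ hL0.le hε, mu_mul_acc hε]
    have hμ := mu_pos (c := c) hε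
    refine (Nat.ceil_lt_add_one (le_max_of_le_left (by positivity))).le.trans ?_
    have e1 : 2048 * L ^ 3 / (8 * L / 2 ^ j) = 256 * L ^ 2 * 2 ^ j := by
      field_simp; ring
    have e2 : 256 * L ^ 2 / (c.mu ε * √(8 * L / 2 ^ j))
        ≤ 256 * L ^ 2 * (c.D : ℝ) ^ 2 / ε * √2 ^ j := by
      have h8 : (1 : ℝ) ≤ √(8 * L) := by rw [Real.one_le_sqrt]; linarith
      have hD := (D_sq_pos (c := c))
      rw [Real.sqrt_div (by positivity), sqrt_two_pow, mu]
      have : 256 * L ^ 2 / (ε / (c.D : ℝ) ^ 2 * (√(8 * L) / √2 ^ j))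
          = 256 * L ^ 2 * (c.D : ℝ) ^ 2 / ε * √2 ^ j / √(8 * L) := by field_simp
      rw [this]
      exact div_le_self (by positivity) h8
    have h10 : (1 : ℝ) ≤ 2 ^ j := one_le_pow₀ one_le_two
    have h11 : √2 ^ j ≤ √2 ^ (j + 1) := pow_le_pow_right₀ hr (Nat.le_succ j)
    have h12 := mul_le_mul_of_nonneg_left h11
      (by positivity : 0 ≤ 256 * L ^ 2 * (c.D : ℝ) ^ 2 / ε)
    have h13 : max (2048 * L ^ 3 / (8 * L / 2 ^ j)) (256 * L ^ 2 / (c.mu ε * √(8 * L / 2 ^ j)))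
        ≤ 256 * L ^ 2 * 2 ^ j + 256 * L ^ 2 * (c.D : ℝ) ^ 2 / ε * √2 ^ j := by
      rw [e1]
      have : 0 ≤ 256 * L ^ 2 * (2 : ℝ) ^ j := by positivity
      have : 0 ≤ 256 * L ^ 2 * (c.D : ℝ) ^ 2 / ε * √2 ^ j := by positivity
      exact max_le (by linarith) (by linarith)
    rw [pow_succ (2 : ℝ) j]
    nlinarith [mul_nonneg hf (by positivity : (0 : ℝ) ≤ 2 ^ j),
      mul_nonneg (sq_nonneg L) (by positivity : (0 : ℝ) ≤ 2 ^ j)]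

theorem samples_le (hL : c.minL ≤ L) (hε : 0 < ε) (hε1 : ε ≤ 1) :
    (c.samples L ε : ℝ) ≤ c.sampleCoef L / ε ^ 2 := by
  obtain ⟨h1, -⟩ := minL_spec hL
  have hL0 : 0 < L := by linarith
  have hno := c.noise_nonneg
  have hf : 0 ≤ c.firstSteps L := by unfold firstSteps; positivity
  have hD := (D_sq_pos (c := c))
  have hS := two_pow_stages_le hL hε hε1
  set S := c.stages L ε
  set Q := 64 * L * (c.D : ℝ) ^ 2 with hQdef
  have hQ : 0 < Q := by positivity
  have e : (c.samples L ε : ℝ) = c.K * ∑ j ∈ Finset.range S, (c.steps L ε (j + 1) : ℝ) := by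
    have : Finset.Icc 1 (c.stages L ε) = Finset.Ico 1 (S + 1) := by ext; simp [S]
    rw [samples, this, Finset.sum_Ico_eq_sum_range]
    push_cast
    rw [Finset.mul_sum]
    simp only [add_comm]
  have g1 : ∑ j ∈ Finset.range S, (2 : ℝ) ^ j ≤ Q / ε ^ 2 := by
    rw [geom_sum_eq (by norm_num)]
    norm_num
    linarith
  have g2 : ∑ j ∈ Finset.range S, √2 ^ j ≤ 3 * (√Q / ε) := by
    -- Gives `1/(√2 - 1) ≤ 3`, the factor in the geometric sum.
    have hr : (4 / 3 : ℝ) ≤ √2 := Real.le_sqrt_of_sq_le (by norm_num)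
    rw [geom_sum_eq (by linarith), div_le_iff₀ (by linarith)]
    have h10 : √2 ^ S ≤ √Q / ε := by
      rw [← sqrt_two_pow]
      refine (Real.sqrt_le_sqrt hS).trans (le_of_eq ?_)
      rw [Real.sqrt_div hQ.le, Real.sqrt_sq hε.le]
    have h11 : 0 ≤ √Q / ε := by positivity
    nlinarith
  have hsum : ∑ j ∈ Finset.range S, (c.steps L ε (j + 1) : ℝ)
      ≤ (c.firstSteps L + 1 + 256 * L ^ 2) * (Q / ε ^ 2)
        + 256 * L ^ 2 * (c.D : ℝ) ^ 2 / ε * (3 * (√Q / ε)) := by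
    refine (Finset.sum_le_sum fun j _ => steps_le hL hε hε1 j).trans ?_
    rw [Finset.sum_add_distrib, ← Finset.mul_sum, ← Finset.mul_sum]
    gcongr
  rw [e]
  refine (mul_le_mul_of_nonneg_left hsum (Nat.cast_nonneg _)).trans (le_of_eq ?_)
  rw [sampleCoef, ← hQdef]
  field_simp
  ring

end Constants

namespace Problem

/-! ### Induction over the stages. -/

section Main

variable {c : Constants} {Ξ : Type*} [MeasurableSpace Ξ] {P : Problem c.K Ξ}
  {Ω : Type*} [mΩ : MeasurableSpace Ω] {Pr : Measure Ω} [IsProbabilityMeasure Pr]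
  {ξ : ℕ → ℕ → ℕ → Ω → Ξ} {τ : ℕ → Ω → ℕ} {L ε : ℝ}

/-- The residual is the quantity to induct on: it bounds both parts of the energy with which the
next stage starts, for that stage's own weight `1/(4Lη)`. -/
theorem Assumptions.lintegral_resid_stage_le (H : P.Assumptions c)
    (hconv : ConvexOn ℝ Set.univ P.F) {x : Vec (P.d 0)} (hx : IsMinOn P.F Set.univ x)
    {w₀ : Vec (P.d 0)} (hw : ‖w₀‖ ≤ c.R) (hΔ : P.F w₀ - ⨅ w, P.F w ≤ c.Δ)
    (hL : c.minL ≤ L) (hε : 0 < ε) (hε1 : ε ≤ 1)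
    (hS : P.Sampling Pr (c.steps L ε) ξ τ) (s : ℕ) :
    ∫⁻ ω, ENNReal.ofReal (P.resid (c.mu ε) L
        (P.ret ξ τ (c.mu ε) (16 * L ^ 2) (c.eta L ε) w₀ (s + 1) ω)) ∂Pr
      ≤ ENNReal.ofReal (2 * (c.mu ε * c.acc L ε (s + 1))) := by
  obtain ⟨h1, -, hC, hg, hs, -, -⟩ := Constants.minL_spec hL
  have hL0 : 0 < L := by linarith
  have hμ := Constants.mu_pos (c := c) hε
  have hb := bddBelow_reg hμ.le hx
  have hC0 := c.trackCoef_nonneg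
  have hno := c.noise_nonneg
  have hstage : ∀ s : ℕ, ∀ {e : ℝ}, 0 ≤ e →
      ∫⁻ ω, ENNReal.ofReal (P.energy (c.mu ε) (1 / (4 * L * c.eta L ε (s + 1)))
          (P.ret ξ τ (c.mu ε) (16 * L ^ 2) (c.eta L ε) w₀ s ω)) ∂Pr ≤ ENNReal.ofReal e →
      ∫⁻ ω, ENNReal.ofReal (P.resid (c.mu ε) L
        (P.ret ξ τ (c.mu ε) (16 * L ^ 2) (c.eta L ε) w₀ (s + 1) ω)) ∂Pr
      ≤ ENNReal.ofReal (2 * e / (c.eta L ε (s + 1) * c.steps L ε (s + 1))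
        + c.initCoef / c.steps L ε (s + 1)
        + 8 * L * c.trackCoef * (16 * L ^ 2 * c.eta L ε (s + 1) ^ 2) * c.noise) := by
    intro s e he0 he
    have hη := Constants.eta_pos (c := c) h1 hε s
    refine H.lintegral_resid_ret_le hS w₀ s (Constants.steps_pos h1 hε s) hb hμ.le
      hη hL0 ?_ (by linarith) (by linarith) ?_ he0 he
    · have h2 := Constants.eta_le (c := c) h1 hε s
      rw [le_div_iff₀ (by positivity)] at h2
      have h3 := Constants.mu_le (c := c) hε1
      nlinarith
    · rw [Constants.eta_sq h1 hε]
      have h2 := Constants.beta_le (c := c) h1 hε s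
      calc _ ≤ 1 / L * L := by gcongr
        _ = 1 := by field_simp
  induction s with
  | zero =>
    have hη := Constants.eta_pos (c := c) h1 hε 0
    have hgap : P.reg (c.mu ε) w₀ - ⨅ w, P.reg (c.mu ε) w ≤ c.gap ε := by
      have h2 := iInf_F_le_iInf_reg hμ.le hx
      have h3 : c.mu ε / 2 * ‖w₀‖ ^ 2 ≤ c.mu ε / 2 * (c.R : ℝ) ^ 2 := by gcongr
      rw [reg, Constants.gap]
      linarith
    have hgap0 : 0 ≤ P.reg (c.mu ε) w₀ - ⨅ w, P.reg (c.mu ε) w := sub_nonneg.2 (ciInf_le hb _)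
    have hE := lintegral_ofReal_affine_le (Pr := Pr) (p := P.reg (c.mu ε) w₀ - ⨅ w, P.reg (c.mu ε) w)
      (q := 1 / (4 * L * c.eta L ε (0 + 1)))
      (H.measurable_trackErr.comp (H.measurable_initState w₀ (hS.fresh 0 0).meas))
      (fun _ => P.trackErr_nonneg _) hgap0 (by positivity) (by positivity)
      (H.lintegral_trackErr_initState_le (hS.fresh 0 0) w₀)
    refine (hstage 0 (e := c.gap ε + 1 / (4 * L * c.eta L ε (0 + 1)) * (c.K * c.noise)) ?_ ?_).trans
      (ENNReal.ofReal_le_ofReal (Constants.first_stage_bound hL hε))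
    · have := Constants.gap_nonneg (c := c) hε
      positivity
    · exact hE.trans (ENNReal.ofReal_le_ofReal (by linarith))
  | succ s ih =>
    have hη : 0 < c.eta L ε (s + 2) := Constants.eta_pos (c := c) h1 hε (s + 1)
    have hq : 0 < c.mu ε * c.acc L ε (s + 1) := by rw [Constants.mu_mul_acc hε]; positivity
    -- The gradient part of the residual controls the gap through the Polyak–Łojasiewicz inequality,
    -- and its tracking part controls the weighted tracking error; the mixed terms are nonnegative.
    have hle : ∀ y : P.State, P.energy (c.mu ε) (1 / (4 * L * c.eta L ε (s + 2))) y
        ≤ 0 + (1 / (2 * c.mu ε) + 1 / (4 * L * c.eta L ε (s + 2)) / (4 * L))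
          * P.resid (c.mu ε) L y := fun y => by
      have h2 := H.reg_sub_iInf_le hconv hμ y.w
      have hV := P.trackErr_nonneg y
      have e : 0 + (1 / (2 * c.mu ε) + 1 / (4 * L * c.eta L ε (s + 2)) / (4 * L))
          * P.resid (c.mu ε) L y = ‖P.gradReg (c.mu ε) y.w‖ ^ 2 / (2 * c.mu ε)
          + 1 / (4 * L * c.eta L ε (s + 2)) * P.trackErr y
          + (1 / (2 * c.mu ε) * (4 * L * P.trackErr y)
            + 1 / (4 * L * c.eta L ε (s + 2)) / (4 * L) * ‖P.gradReg (c.mu ε) y.w‖ ^ 2) := by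
        rw [resid]; field_simp; ring
      have h3 : 0 ≤ 1 / (2 * c.mu ε) * (4 * L * P.trackErr y)
            + 1 / (4 * L * c.eta L ε (s + 2)) / (4 * L) * ‖P.gradReg (c.mu ε) y.w‖ ^ 2 := by
        positivity
      rw [e, energy]
      linarith
    refine (hstage (s + 1) (e := (1 / (2 * c.mu ε) + 1 / (4 * L * c.eta L ε (s + 2)) / (4 * L))
          * (2 * (c.mu ε * c.acc L ε (s + 1)))) (by positivity) ?_).trans
      (ENNReal.ofReal_le_ofReal (Constants.later_stage_bound hL hε s))
    refine (lintegral_mono fun ω => ENNReal.ofReal_le_ofReal (hle _)).trans ?_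
    refine (lintegral_ofReal_affine_le ((H.measurable_resid (c.mu ε) L).comp
      (H.measurable_ret' hS (c.mu ε) (16 * L ^ 2) (c.eta L ε) w₀ (s + 1)))
      (fun _ => P.resid_nonneg hL0.le _) le_rfl (by positivity) (by positivity) ih).trans ?_
    rw [zero_add]

end Main

end Problem

end SMVR

/-! ### From the regularized to the original objective. -/

theorem theorem3 (c : SMVR.Constants) :
    ∃ L₀ : ℝ, ∀ L : ℝ, L₀ ≤ L → ∃ C : ℝ, ∀ ε : ℝ, 0 < ε → ε ≤ 1 →
      (c.samples L ε : ℝ) ≤ C / ε ^ 2 ∧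
      ∀ (Ξ : Type*) [MeasurableSpace Ξ] (P : SMVR.Problem c.K Ξ), P.Assumptions c →
        ConvexOn ℝ Set.univ P.F →
        (∃ x, IsMinOn P.F Set.univ x ∧ ‖x‖ ≤ c.D) →
        ∀ w₀ : SMVR.Vec (P.d 0), ‖w₀‖ ≤ c.R → P.F w₀ - ⨅ w, P.F w ≤ c.Δ →
        ∀ (Ω : Type*) [MeasurableSpace Ω] (Pr : Measure Ω) [IsProbabilityMeasure Pr]
          (ξ : ℕ → ℕ → ℕ → Ω → Ξ) (τ : ℕ → Ω → ℕ),
          P.Sampling Pr (c.steps L ε) ξ τ →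
          Integrable (fun ω => P.F (SMVR.output c P L ε w₀
            (fun s n i => ξ s n i ω) (fun s => τ s ω)) - ⨅ w, P.F w) Pr ∧
          ∫ ω, (P.F (SMVR.output c P L ε w₀
            (fun s n i => ξ s n i ω) (fun s => τ s ω)) - ⨅ w, P.F w) ∂Pr ≤ ε := by
  refine ⟨c.minL, fun L hL => ⟨c.sampleCoef L, fun ε hε hε1 =>
    ⟨SMVR.Constants.samples_le hL hε hε1, ?_⟩⟩⟩
  intro Ξ _ P H hconv ⟨x, hx, hxD⟩ w₀ hw hΔ Ω _ Pr _ ξ τ hS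
  obtain ⟨h1, -⟩ := SMVR.Constants.minL_spec hL
  have hμ := SMVR.Constants.mu_pos (c := c) hε
  obtain ⟨s, hs⟩ := Nat.exists_eq_succ_of_ne_zero (SMVR.Constants.stages_pos hL hε hε1).ne'
  have hacc := SMVR.Constants.acc_stages_le hL hε hε1
  have hR := H.lintegral_resid_stage_le hconv hx hw hΔ hL hε hε1 hS s
  rw [hs] at hacc
  have hacc0 : 0 < c.mu ε * c.acc L ε (s + 1) := by
    rw [SMVR.Constants.mu_mul_acc hε]; positivity
  have hXm := H.measurable_ret' hS (c.mu ε) (16 * L ^ 2) (c.eta L ε) w₀ (s + 1)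
  set X := P.ret ξ τ (c.mu ε) (16 * L ^ 2) (c.eta L ε) w₀ (s + 1) with hX
  have hout : ∀ ω, SMVR.output c P L ε w₀ (fun s n i => ξ s n i ω) (fun s => τ s ω) = (X ω).w :=
    fun ω => by rw [SMVR.output, hs]; rfl
  simp only [hout]
  -- Compare `F ≤ G` at the output with `G* ≤ F* + μ/2 ‖x‖²` at the minimizer `x`; the choice `μ =
  -- ε/D²` makes the last term at most `ε/2`.
  have hpt : ∀ y : P.State, P.F y.w - ⨅ w, P.F w
      ≤ ε / 2 + 1 / (2 * c.mu ε) * P.resid (c.mu ε) L y := fun y => by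
    have h2 := H.reg_sub_iInf_le hconv hμ y.w
    have h3 : ⨅ w, P.reg (c.mu ε) w ≤ P.reg (c.mu ε) x :=
      ciInf_le (SMVR.Problem.bddBelow_reg hμ.le hx) x
    have h4 : c.mu ε / 2 * ‖x‖ ^ 2 ≤ ε / 2 := by
      have hD : (0 : ℝ) < c.D := c.D_pos
      calc c.mu ε / 2 * ‖x‖ ^ 2 ≤ c.mu ε / 2 * (c.D : ℝ) ^ 2 := by gcongr
        _ = ε / 2 := by rw [SMVR.Constants.mu]; field_simp
    have h5 : 0 ≤ c.mu ε / 2 * ‖y.w‖ ^ 2 := by positivity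
    have h6 : ‖P.gradReg (c.mu ε) y.w‖ ^ 2 / (2 * c.mu ε)
        ≤ 1 / (2 * c.mu ε) * P.resid (c.mu ε) L y := by
      have hV := P.trackErr_nonneg y
      rw [SMVR.Problem.resid, mul_add, one_div_mul_eq_div]
      exact le_add_of_nonneg_right (by positivity)
    rw [SMVR.Problem.iInf_F_eq hx]
    rw [SMVR.Problem.reg] at h2 h3
    linarith
  have h0 : ∀ y : P.State, 0 ≤ P.F y.w - ⨅ w, P.F w := fun y =>
    sub_nonneg.2 (ciInf_le (SMVR.Problem.bddBelow_F hx) _)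
  have hm : Measurable fun ω => P.F (X ω).w - ⨅ w, P.F w :=
    (H.continuous_F.measurable.comp (SMVR.Problem.measurable_w.comp hXm)).sub_const _
  have hle : ∫⁻ ω, ENNReal.ofReal (P.F (X ω).w - ⨅ w, P.F w) ∂Pr ≤ ENNReal.ofReal ε := by
    refine (lintegral_mono fun ω => ENNReal.ofReal_le_ofReal (hpt (X ω))).trans ?_
    refine (SMVR.lintegral_ofReal_affine_le ((H.measurable_resid (c.mu ε) L).comp hXm)
      (fun _ => P.resid_nonneg (by linarith) _) (by positivity) (by positivity) (by positivity)
      hR).trans (ENNReal.ofReal_le_ofReal ?_)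
    have : 1 / (2 * c.mu ε) * (2 * (c.mu ε * c.acc L ε (s + 1))) = c.acc L ε (s + 1) := by
      field_simp
    rw [this]
    simp only [Nat.succ_eq_add_one] at hacc
    linarith
  -- The gap is nonnegative, so the finite bound on its `ℝ≥0∞`-valued expectation also gives
  -- integrability.
  refine ⟨⟨hm.aestronglyMeasurable, ?_⟩, ?_⟩
  · rw [hasFiniteIntegral_iff_ofReal (.of_forall fun ω => h0 _)]
    exact hle.trans_lt ENNReal.ofReal_lt_top
  · rw [integral_eq_lintegral_of_nonneg_ae (.of_forall fun ω => h0 _) hm.aestronglyMeasurable]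
    exact ENNReal.toReal_le_of_le_ofReal hε.le hle
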